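/- Let $d\ge 1$, let $N\simeq\mathbb Z^d$ be a lattice with dual $M=\operatorname{Hom}(N,\mathbb Z)$ and pairing $\langle\cdot,\cdot\rangle:M_{\mathbb R}\times N_{\mathbb R}\to\mathbb R$, and let $\nabla\subset M_{\mathbb R}$ be a convex polytope with vertices in $M$ which is \emph{absolutely simple}: each vertex $S$ of $\nabla$ lies on exactly $d$ edges, and if $m_1,\dots,m_d$ denote the points of $M$ distinct from $S$ and closest to $S$ on these edges, then $l_i(S)=m_i-S$ $(1\le i\le d)$ form a $\mathbb Z$-basis of $M$. \emph{The invariant $L(\nabla)$.} Let $\psi_\nabla(u)=\inf_{v\in\nabla}\langle v,u\rangle$ be the support function of $\nabla$, let $\Delta$ be the normal fan of $\nabla$ (the coarsest complete fan in $N_{\mathbb R}$ on whose cones $\psi_\nabla$ is linear), let $\mathbb P(\nabla)$ be the toric variety of $\Delta$ and let $E$ be the ample torus-invariant Cartier divisor on it with support function $\psi_\nabla$, that is, $\mathcal O(E)$ is generated on the affine chart $U_\sigma$, $\sigma\in\Delta$, by the character $\chi^{m_\sigma}$, where $m_\sigma\in M$ and $\psi_\nabla=\langle m_\sigma,\cdot\rangle$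 on $\sigma$. Equip $\mathcal O(E)$ with its canonical metric $$\|s(x)\|_{E,\infty}=\frac{|s(x)|}{\sup_{m\in\nabla\cap M}|\chi^m(x)|}\qquad(x\in\mathbb P(\nabla)(\mathbb C)),$$ where in the chart $U_\sigma$ the numerator and the denominator are both divided by $|\chi^{m_\sigma}(x)|$. For a nonzero global section $s$, regarded as a rational function on $\mathbb P(\nabla)$, let $M(s)=\int\log|s|\,d\mu$ be its Mahler measure, the integral being taken over the compact torus $\operatorname{Hom}(M,S^1)$ with its normalised Haar measure $\mu$. Put $$L(\nabla)=\sup_{0\ne s\in\Gamma(\mathbb P(\nabla)(\mathbb C),\mathcal O(E))}\Bigl(\sup_{x\in\mathbb P(\nabla)(\mathbb C)}\log\|s(x)\|_{E,\infty}-M(s)\Bigr),\qquad \log 0=-\infty .$$ \emph{The norm $N(\nabla)$.} For vertices $S,S'$ of $\nabla$ write $S'-S=\sum_{i=1}^d a_i\,l_i(S)$ with integers $a_i$ and put $N_S(S')=\sum_{i=1}^d a_i$. Let $N(\nabla)=\max N_S(S')$ over all pairs of distinct vertices $S\neq S'$ of $\nabla$. \emph{The constants.} Put $$C_d=\frac12\sum_{i=1}^{d-1}\frac1i,\qquad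 C_d'=\sum_{i=1}^{2d-2}\frac1i+\sum_{i=2d-1}^{\infty}\frac1{i\,2^i}.$$ Then $$L(\nabla)\le (C_d+C_d')\,N(\nabla).$$ -/

import Mathlib

open MeasureTheory
open scoped ENNReal Matrix

noncomputable section

namespace Toric

/-! ### Lattices, lattice polytopes, faces

The lattice `N ≃ ℤ^d` carries a chosen basis, so `M = Hom(N, ℤ)` is `Fin d → ℤ`, the real spaces
`M_ℝ` and `N_ℝ` are `Fin d → ℝ`, and the pairing `⟨v, u⟩` is the dot product `v ⬝ᵥ u`. -/

/-- The inclusion `M → M_ℝ`. -/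
def toReal {d : ℕ} (m : Fin d → ℤ) : Fin d → ℝ := fun i => (m i : ℝ)

theorem toReal_add {d : ℕ} (m n : Fin d → ℤ) : toReal (m + n) = toReal m + toReal n := by
  funext i; simp [toReal]

theorem toReal_sub {d : ℕ} (m n : Fin d → ℤ) : toReal (m - n) = toReal m - toReal n := by
  funext i; simp [toReal]

theorem toReal_zero {d : ℕ} : toReal (0 : Fin d → ℤ) = 0 := by
  funext i; simp [toReal]

/-- Convex polytopes in `M_ℝ` with vertices in `M`: convex hulls of nonempty finite subsets
of `M`. -/
def IsLatticePolytope {d : ℕ} (K : Set (Fin d → ℝ)) : Prop :=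
  ∃ S : Finset (Fin d → ℤ), S.Nonempty ∧ K = convexHull ℝ (toReal '' (S : Set (Fin d → ℤ)))

/-- The vertices of a polytope that lie in `M` (all vertices, for a lattice polytope). -/
def vertices {d : ℕ} (K : Set (Fin d → ℝ)) : Set (Fin d → ℤ) :=
  {m | toReal m ∈ K.extremePoints ℝ}

/-- Nonempty faces: the subsets of `K` on which a linear form attains its extremum. -/
def IsFace {d : ℕ} (K F : Set (Fin d → ℝ)) : Prop :=
  F.Nonempty ∧ IsExposed ℝ K F

/-- Edges: faces of dimension one. -/
def IsEdge {d : ℕ} (K F : Set (Fin d → ℝ)) : Prop :=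
  IsFace K F ∧ Module.finrank ℝ (vectorSpan ℝ F) = 1

/-- The vectors `m - S`, where `m` is the point of `M` distinct from the vertex `S` and closest to
`S` on one of the edges of `K` through `S`. -/
def edgeVectors {d : ℕ} (K : Set (Fin d → ℝ)) (S : Fin d → ℤ) : Set (Fin d → ℤ) :=
  {l | ∃ F, IsEdge K F ∧ toReal S ∈ F ∧ l ≠ 0 ∧ toReal (S + l) ∈ F ∧
    ∀ l' : Fin d → ℤ, l' ≠ 0 → toReal (S + l') ∈ F →
      toReal (S + l) ∈ segment ℝ (toReal S) (toReal (S + l'))}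

/-- Absolutely simple polytopes: every vertex `S` lies on exactly `d` edges, and the differences
to `S` of the closest points of `M` on these edges form a `ℤ`-basis of `M`. -/
structure IsAbsolutelySimple {d : ℕ} (K : Set (Fin d → ℝ)) : Prop where
  card_edges : ∀ S ∈ vertices K, {F | IsEdge K F ∧ toReal S ∈ F}.ncard = d
  linearIndependent : ∀ S ∈ vertices K,
    LinearIndependent ℤ (Subtype.val : edgeVectors K S → (Fin d → ℤ))
  span_eq_top : ∀ S ∈ vertices K, Submodule.span ℤ (edgeVectors K S) = ⊤

/-- The basis of `M` attached to a vertex of an absolutely simple polytope. -/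
def edgeBasis {d : ℕ} {K : Set (Fin d → ℝ)} (hK : IsAbsolutelySimple K) {S : Fin d → ℤ}
    (hS : S ∈ vertices K) : Module.Basis (edgeVectors K S) ℤ (Fin d → ℤ) :=
  Module.Basis.mk (hK.linearIndependent S hS) (by
    rw [Subtype.range_coe]; exact (hK.span_eq_top S hS).ge)

/-- `N_S(P)`: the sum of the coordinates of `P - S` in the basis attached to the vertex `S`. -/
def vertexNorm {d : ℕ} {K : Set (Fin d → ℝ)} (hK : IsAbsolutelySimple K) {S : Fin d → ℤ}
    (hS : S ∈ vertices K) (P : Fin d → ℤ) : ℤ :=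
  ((edgeBasis hK hS).repr (P - S)).sum fun _ a => a

/-- The norm `N(K)` of an absolutely simple polytope: the maximum of `N_S(S')` over the pairs of
distinct vertices. -/
def polytopeNorm {d : ℕ} {K : Set (Fin d → ℝ)} (hK : IsAbsolutelySimple K) : ℤ :=
  sSup {n | ∃ (S S' : Fin d → ℤ) (hS : S ∈ vertices K), S' ∈ vertices K ∧ S' ≠ S ∧
    n = vertexNorm hK hS S'}

/-! ### Complex points of toric varieties -/

/-- The semigroup `S_σ = M ∩ σ^*` of a cone `σ` in `N_ℝ`. -/
def dualMonoid {d : ℕ} (σ : Set (Fin d → ℝ)) : AddSubmonoid (Fin d → ℤ) where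
  carrier := {m | ∀ u ∈ σ, 0 ≤ toReal m ⬝ᵥ u}
  zero_mem' := by intro u _; simp [toReal_zero]
  add_mem' := by
    intro a b ha hb u hu
    rw [toReal_add, add_dotProduct]
    exact add_nonneg (ha u hu) (hb u hu)

theorem dualMonoid_anti {d : ℕ} {τ σ : Set (Fin d → ℝ)} (h : τ ⊆ σ) :
    dualMonoid σ ≤ dualMonoid τ := fun _ hm u hu => hm u (h hu)

/-- The algebra `ℂ[S_σ]` of regular functions on the affine toric variety `U_σ`. -/
abbrev CoordRing {d : ℕ} (σ : Set (Fin d → ℝ)) : Type := AddMonoidAlgebra ℂ (dualMonoid σ)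

/-- Laurent polynomials `ℂ[M]`: the regular functions on the torus `T`. -/
abbrev Laurent (d : ℕ) : Type := AddMonoidAlgebra ℂ (Fin d → ℤ)

/-- The complex points `U_σ(ℂ)` of `U_σ = Spec ℤ[S_σ]`. -/
abbrev AffinePoints {d : ℕ} (σ : Set (Fin d → ℝ)) : Type := CoordRing σ →ₐ[ℂ] ℂ

/-- The character `χ^m`, `m ∈ S_σ`, as a regular function on `U_σ`. -/
def character {d : ℕ} {σ : Set (Fin d → ℝ)} (m : dualMonoid σ) : CoordRing σ :=
  AddMonoidAlgebra.single m 1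

/-- Restriction of regular functions from `U_σ` to `U_τ`, for `τ ⊆ σ`. -/
def restrict {d : ℕ} {τ σ : Set (Fin d → ℝ)} (h : τ ⊆ σ) : CoordRing σ →ₐ[ℂ] CoordRing τ :=
  AddMonoidAlgebra.mapDomainAlgHom ℂ ℂ (AddSubmonoid.inclusion (dualMonoid_anti h))

/-- Restriction of regular functions from `U_σ` to the torus `T`. -/
def toLaurent {d : ℕ} (σ : Set (Fin d → ℝ)) : CoordRing σ →ₐ[ℂ] Laurent d :=
  AddMonoidAlgebra.mapDomainAlgHom ℂ ℂ (dualMonoid σ).subtype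

/-- The gluing of the affine toric varieties: for cones `τ ⊆ σ` in `Δ`, a point of `U_τ` is
identified with its image in `U_σ`. -/
inductive Glue {d : ℕ} (Δ : Set (Set (Fin d → ℝ))) :
    (Σ σ : Δ, AffinePoints σ.1) → (Σ σ : Δ, AffinePoints σ.1) → Prop
  | mk (τ σ : Δ) (h : τ.1 ⊆ σ.1) (y : AffinePoints τ.1) :
      Glue Δ ⟨τ, y⟩ ⟨σ, y.comp (restrict h)⟩

/-- The set `ℙ(Δ)(ℂ)` of complex points of the toric variety of the fan `Δ`. -/
def ComplexPoints {d : ℕ} (Δ : Set (Set (Fin d → ℝ))) : Type := Quot (Glue Δ)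

/-! ### Invariant Cartier divisors, their sections, and the canonical metric -/

/-- A horizontal `T`-invariant Cartier divisor `D` on `ℙ(Δ)`: its support function `ψ_D`, given on
each cone `σ` of `Δ` by an element `m_{D,σ}` of `M`; the character `χ^{m_{D,σ}}` generates `𝒪(D)`
on `U_σ`. -/
structure InvariantDivisor {d : ℕ} (Δ : Set (Set (Fin d → ℝ))) where
  supp : (Fin d → ℝ) → ℝ
  loc : Δ → (Fin d → ℤ)
  supp_eq : ∀ (σ : Δ), ∀ u ∈ σ.1, supp u = toReal (loc σ) ⬝ᵥ u

/-- The polytope `K_D`. -/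
def InvariantDivisor.polytope {d : ℕ} {Δ : Set (Set (Fin d → ℝ))} (D : InvariantDivisor Δ) :
    Set (Fin d → ℝ) :=
  {v | ∀ u, D.supp u ≤ v ⬝ᵥ u}

/-- Global sections of `𝒪(D)` over `ℙ(Δ)_ℂ`: rational functions, regular on the torus, which on
every `U_σ` are of the form `f_σ χ^{m_{D,σ}}` with `f_σ` regular on `U_σ`. -/
structure GlobalSection {d : ℕ} {Δ : Set (Set (Fin d → ℝ))} (D : InvariantDivisor Δ) where
  fn : Laurent d
  coord : ∀ σ : Δ, CoordRing σ.1
  fn_eq : ∀ σ : Δ, fn = toLaurent σ.1 (coord σ) * AddMonoidAlgebra.single (D.loc σ) 1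

theorem InvariantDivisor.sub_loc_mem {d : ℕ} {Δ : Set (Set (Fin d → ℝ))} (D : InvariantDivisor Δ)
    (σ : Δ) {m : Fin d → ℤ} (hm : toReal m ∈ D.polytope) :
    m - D.loc σ ∈ dualMonoid σ.1 := by
  intro u hu
  rw [toReal_sub, sub_dotProduct, ← D.supp_eq σ u hu]
  exact sub_nonneg.2 (hm u)

/-- The canonical metric `‖s(x)‖ = |s(x)| / sup_{m ∈ K_D ∩ M} |χ^m(x)|` of a divisor `D` whose
sheaf `𝒪(D)` is globally generated, computed at `x ∈ U_σ(ℂ)` by dividing the numerator and the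
denominator by the local generator `χ^{m_{D,σ}}`. -/
def chartNorm {d : ℕ} {Δ : Set (Set (Fin d → ℝ))} (D : InvariantDivisor Δ) (s : GlobalSection D)
    (p : Σ σ : Δ, AffinePoints σ.1) : ℝ :=
  ‖p.2 (s.coord p.1)‖ /
    ⨆ m : {m : Fin d → ℤ // toReal m ∈ D.polytope},
      ‖p.2 (character ⟨m.1 - D.loc p.1, D.sub_loc_mem p.1 m.2⟩)‖

theorem toLaurent_injective {d : ℕ} (σ : Set (Fin d → ℝ)) :
    Function.Injective (toLaurent σ) :=
  AddMonoidAlgebra.mapDomain_injective Subtype.val_injective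

theorem toLaurent_restrict {d : ℕ} {τ σ : Set (Fin d → ℝ)} (h : τ ⊆ σ) (f : CoordRing σ) :
    toLaurent τ (restrict h f) = toLaurent σ f := by
  have : (toLaurent τ).comp (restrict h) = toLaurent σ := by
    rw [toLaurent, restrict, ← AddMonoidAlgebra.mapDomainAlgHom_comp]; rfl
  exact DFunLike.congr_fun this f

theorem toLaurent_character {d : ℕ} {σ : Set (Fin d → ℝ)} (m : dualMonoid σ) :
    toLaurent σ (character m) = AddMonoidAlgebra.single m.1 1 := by
  simp [toLaurent, character]

theorem character_add {d : ℕ} {σ : Set (Fin d → ℝ)} (m n : dualMonoid σ) :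
    character (m + n) = character m * character n := by
  simp [character, AddMonoidAlgebra.single_mul_single]

theorem restrict_character {d : ℕ} {τ σ : Set (Fin d → ℝ)} (h : τ ⊆ σ) (m : dualMonoid σ) :
    restrict h (character m) = character ⟨m.1, dualMonoid_anti h m.2⟩ := by
  apply toLaurent_injective
  rw [toLaurent_restrict, toLaurent_character, toLaurent_character]

/-- The metric does not depend on the chart. -/
theorem chartNorm_glue {d : ℕ} {Δ : Set (Set (Fin d → ℝ))} (D : InvariantDivisor Δ)
    (s : GlobalSection D) (p q : Σ σ : Δ, AffinePoints σ.1) (h : Glue Δ p q) :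
    chartNorm D s p = chartNorm D s q := by
  obtain ⟨τ, σ, h, y⟩ := h
  have key : ∀ u ∈ τ.1, toReal (D.loc σ) ⬝ᵥ u = toReal (D.loc τ) ⬝ᵥ u := fun u hu => by
    rw [← D.supp_eq σ u (h hu), ← D.supp_eq τ u hu]
  have h1 : D.loc σ - D.loc τ ∈ dualMonoid τ.1 := fun u hu => by
    rw [toReal_sub, sub_dotProduct, key u hu, sub_self]
  have h2 : D.loc τ - D.loc σ ∈ dualMonoid τ.1 := fun u hu => by
    rw [toReal_sub, sub_dotProduct, key u hu, sub_self]
  set c : ℂ := y (character ⟨_, h1⟩) with hc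
  have hc0 : c ≠ 0 := by
    intro h0
    have : y (character (⟨_, h1⟩ + ⟨_, h2⟩)) = 0 := by
      rw [character_add, map_mul, ← hc, h0, zero_mul]
    have h3 : (⟨_, h1⟩ + ⟨_, h2⟩ : dualMonoid τ.1) = 0 := by
      apply Subtype.ext; simp
    rw [h3] at this
    have h4 : (character (0 : dualMonoid τ.1)) = 1 := rfl
    rw [h4, map_one] at this
    exact one_ne_zero this
  have hnum : y (s.coord τ) = y (restrict h (s.coord σ)) * c := by
    rw [hc, ← map_mul]
    congr 1
    apply toLaurent_injective
    rw [map_mul, toLaurent_restrict, toLaurent_character]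
    have e := (s.fn_eq τ).symm.trans (s.fn_eq σ)
    have e' := congrArg (fun f => f * (AddMonoidAlgebra.single (-D.loc τ) 1 : Laurent d)) e
    simp only [mul_assoc, AddMonoidAlgebra.single_mul_single, add_neg_cancel, one_mul] at e'
    rw [← AddMonoidAlgebra.one_def, mul_one] at e'
    simp only [e', sub_eq_add_neg]
  have hden : ∀ m : {m : Fin d → ℤ // toReal m ∈ D.polytope},
      ‖y (character ⟨m.1 - D.loc τ, D.sub_loc_mem τ m.2⟩)‖ =
      ‖c‖ * ‖(y.comp (restrict h)) (character ⟨m.1 - D.loc σ, D.sub_loc_mem σ m.2⟩)‖ := by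
    intro m
    rw [AlgHom.comp_apply, restrict_character, hc, ← norm_mul, ← map_mul, ← character_add]
    congr 3
    apply Subtype.ext
    simp
  unfold chartNorm
  simp only [hden]
  rw [← Real.mul_iSup_of_nonneg (norm_nonneg c), hnum, norm_mul, mul_comm ‖c‖,
    mul_div_mul_right _ _ (norm_ne_zero_iff.2 hc0), AlgHom.comp_apply]

/-- The canonical metric `‖s(x)‖_{D,∞}` at a point `x` of `ℙ(Δ)(ℂ)`. -/
def canonicalNorm {d : ℕ} {Δ : Set (Set (Fin d → ℝ))} (D : InvariantDivisor Δ)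
    (s : GlobalSection D) : ComplexPoints Δ → ℝ :=
  Quot.lift (chartNorm D s) (chartNorm_glue D s)

/-- The Mahler measure of a Laurent polynomial: the integral of `log |f|` over the compact torus
`(ℝ/ℤ)^d ≃ (S^1)^d` for the normalised Haar measure; `UnitAddTorus.mFourier m` is the restriction
of `χ^m` to the compact torus. -/
def mahler {d : ℕ} (f : Laurent d) : ℝ :=
  ∫ t : Fin d → UnitAddCircle, Real.log ‖f.coeff.sum fun m a => a * UnitAddTorus.mFourier m t‖
    ∂(Measure.pi fun _ => AddCircle.haarAddCircle)

/-! ### The toric variety and the divisor of a lattice polytope -/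

/-- The cone of all `u ∈ N_ℝ` for which the linear form `⟨·, u⟩` attains its minimum over `K` at
all points of `F`. -/
def normalCone {d : ℕ} (K F : Set (Fin d → ℝ)) : Set (Fin d → ℝ) :=
  {u | ∀ w ∈ F, ∀ v ∈ K, w ⬝ᵥ u ≤ v ⬝ᵥ u}

/-- The fan of `K`: the cones of all nonempty faces of `K`. For a polytope with nonempty interior
it is the coarsest complete fan on whose cones the support function of `K` is linear. -/
def normalFan {d : ℕ} (K : Set (Fin d → ℝ)) : Set (Set (Fin d → ℝ)) :=
  {σ | ∃ F, IsFace K F ∧ σ = normalCone K F}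

/-- The support function `ψ_K(u) = inf_{v ∈ K} ⟨v, u⟩`. -/
def supportFunction {d : ℕ} (K : Set (Fin d → ℝ)) (u : Fin d → ℝ) : ℝ :=
  sInf ((fun v => v ⬝ᵥ u) '' K)

theorem exists_loc {d : ℕ} {K : Set (Fin d → ℝ)} (hK : IsLatticePolytope K) (σ : normalFan K) :
    ∃ m : Fin d → ℤ, ∀ u ∈ σ.1, supportFunction K u = toReal m ⬝ᵥ u := by
  classical
  obtain ⟨σ, F, ⟨⟨w, hw⟩, hF⟩, rfl⟩ := σ
  obtain ⟨S, -, hS⟩ := hK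
  have hwK : w ∈ K := hF.subset hw
  have hwS : w ∈ convexHull ℝ ((S.image toReal : Finset (Fin d → ℝ)) : Set (Fin d → ℝ)) := by
    rwa [Finset.coe_image, ← hS]
  obtain ⟨c, hc0, hc1, hcw⟩ := Finset.mem_convexHull'.1 hwS
  obtain ⟨y, hy, hyc⟩ : ∃ y ∈ S.image toReal, 0 < c y := by
    by_contra! hcon
    have := Finset.sum_nonpos hcon
    linarith
  obtain ⟨m, hm, rfl⟩ := Finset.mem_image.1 hy
  refine ⟨m, fun u hu => ?_⟩
  have hmin : ∀ v ∈ K, w ⬝ᵥ u ≤ v ⬝ᵥ u := hu w hw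
  have hSK : ∀ z ∈ S.image toReal, z ∈ K := fun z hz => by
    rw [hS]
    apply subset_convexHull
    rwa [← Finset.coe_image]
  have hsum : ∑ z ∈ S.image toReal, c z * (z ⬝ᵥ u - w ⬝ᵥ u) = 0 := by
    have : (∑ z ∈ S.image toReal, c z • z) ⬝ᵥ u = w ⬝ᵥ u := by rw [hcw]
    rw [sum_dotProduct] at this
    simp only [smul_dotProduct, smul_eq_mul] at this
    simp only [mul_sub, Finset.sum_sub_distrib, ← Finset.sum_mul]
    rw [this, hc1]; ring
  have hz := (Finset.sum_eq_zero_iff_of_nonneg (fun z hz =>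
    mul_nonneg (hc0 z hz) (sub_nonneg.2 (hmin z (hSK z hz))))).1 hsum _ hy
  have hmw : toReal m ⬝ᵥ u = w ⬝ᵥ u := by
    rcases mul_eq_zero.1 hz with h | h
    · exact absurd h hyc.ne'
    · linarith
  rw [hmw]
  refine IsLeast.csInf_eq ⟨⟨w, hwK, rfl⟩, ?_⟩
  rintro _ ⟨v, hv, rfl⟩
  exact hmin v hv

/-- The divisor `E` on the toric variety of `K` whose support function is `ψ_K` (so that
`K_E = K`). -/
def polytopeDivisor {d : ℕ} {K : Set (Fin d → ℝ)} (hK : IsLatticePolytope K) :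
    InvariantDivisor (normalFan K) where
  supp := supportFunction K
  loc σ := (exists_loc hK σ).choose
  supp_eq σ := (exists_loc hK σ).choose_spec

/-- The invariant `L(K)`: the supremum over the nonzero global sections `s` of `𝒪(E)` of
`sup_x log ‖s(x)‖_{E,∞} - M(s)`, where `log 0 = -∞`. It is formed in `[-∞, +∞]`, so that no
boundedness is presupposed. -/
def invariantL {d : ℕ} {K : Set (Fin d → ℝ)} (hK : IsLatticePolytope K) : EReal :=
  ⨆ (s : GlobalSection (polytopeDivisor hK)) (_ : s.fn ≠ 0),
    (⨆ x : ComplexPoints (normalFan K),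
      ENNReal.log (ENNReal.ofReal (canonicalNorm (polytopeDivisor hK) s x))) - (mahler s.fn : EReal)

/-! ### Lelong's constants -/

/-- `C_n = (1/2) ∑_{i=1}^{n-1} 1/i`. -/
def lelongC (n : ℕ) : ℝ := 1 / 2 * ∑ i ∈ Finset.Icc 1 (n - 1), 1 / (i : ℝ)

/-- `C'_n = ∑_{i=1}^{2n-2} 1/i + ∑_{i ≥ 2n-1} 1/(i 2^i)`, for `n ≥ 1`. -/
def lelongC' (n : ℕ) : ℝ :=
  ∑ i ∈ Finset.Icc 1 (2 * n - 2), 1 / (i : ℝ) +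
    ∑' k : ℕ, 1 / (((2 * n - 1 + k : ℕ) : ℝ) * 2 ^ (2 * n - 1 + k))

end Toric

end

noncomputable section

namespace Toric

/-! ### Mahler measures and the sum of the absolute values of the coefficients -/

/-! Everything goes through the sum `‖s‖₁` of the absolute values of the coefficients of a section
`s`.

The exponents of `s` are lattice points of `K` (`GlobalSection.toReal_mem`), and at each point of
the toric variety the absolute value of each such monomial is at most the denominator of the
canonical metric. Hence the canonical norm is at most `‖s‖₁` everywhere
(`canonicalNorm_le_sum_norm_coeff`).

To compare `‖s‖₁` with the Mahler measure, fix a vertex `S`. The cone of `K` at `S` is generated by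
the edge vectors (`le_of_nonneg_edgeVectors`), which form a lattice basis, so in these coordinates
`s / χ^S` is a genuine polynomial in `d` variables. Its total degree is at most `N = N(K)`, because
a linear form on `K` is largest at a vertex (`vertexNorm_le_polytopeNorm`). The change of
coordinates is an automorphism of the compact torus, and `|χ^S| = 1` there, so the Mahler measure is
unchanged.

For a polynomial of total degree at most `D` in `n` variables, `‖f‖₁ ≤ (n + 1)^D exp M(f)`
(`sum_norm_le_exp_lintegral`). The proof is by induction on `n`: the coefficient of `x₁^k` has
degree at most `D - k`, and the one-variable inequality `|p_k| ≤ binom(D, k) exp M(p)`, integrated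
over the other variables, bounds its Mahler measure. Summation over `k` is the binomial theorem.

Thus `L(K) ≤ N log (d + 1)`, and `log (d + 1) ≤ C_d + C_d'` (`log_add_one_le_lelongC`).

The integrals are handled through `logDefect`, a nonnegative function with value `∞` at zeros, so
that Tonelli applies before integrability is known. -/

instance : IsProbabilityMeasure (volume : Measure UnitAddCircle) :=
  ⟨by simp⟩

theorem haarAddCircle_one : (AddCircle.haarAddCircle : Measure UnitAddCircle) = volume := by
  rw [AddCircle.volume_eq_smul_haarAddCircle, ENNReal.ofReal_one, one_smul]

theorem fourier_one_coe_eq_circleMap (a : ℝ) :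
    fourier 1 (a : UnitAddCircle) = circleMap 0 1 (2 * Real.pi * a) := by
  rw [fourier_coe_apply, circleMap]
  push_cast
  simp only [zero_add, one_mul, div_one, mul_one]
  congr 1
  ring

theorem norm_fourier_one (t : UnitAddCircle) : ‖fourier 1 t‖ = 1 := by
  rw [fourier_one, Circle.norm_coe]

theorem integrable_log_norm_eval_fourier (p : Polynomial ℂ) :
    Integrable (fun t : UnitAddCircle => Real.log ‖p.eval (fourier 1 t)‖) := by
  have hm : Measurable (fun t : UnitAddCircle => Real.log ‖p.eval (fourier 1 t)‖) :=
    Real.measurable_log.comp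
      (p.continuous.comp (fourier 1).continuous).norm.measurable
  rw [← (UnitAddCircle.measurePreserving_mk 0).integrable_comp hm.aestronglyMeasurable, zero_add]
  have h := (p.intervalIntegrable_mahlerMeasure).comp_mul_left (c := 2 * Real.pi)
  rw [zero_div, div_self Real.two_pi_pos.ne', intervalIntegrable_iff_integrableOn_Ioc_of_le
    zero_le_one] at h
  refine h.congr (Filter.Eventually.of_forall fun a => ?_)
  simp only [Function.comp]
  rw [← fourier_one_coe_eq_circleMap]

theorem integral_log_norm_eval_fourier (p : Polynomial ℂ) :
    ∫ t : UnitAddCircle, Real.log ‖p.eval (fourier 1 t)‖ = p.logMahlerMeasure := by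
  rw [← UnitAddCircle.integral_preimage 0, zero_add,
    ← intervalIntegral.integral_of_le zero_le_one, Polynomial.logMahlerMeasure_def,
    Real.circleAverage]
  simp only [fourier_one_coe_eq_circleMap]
  rw [intervalIntegral.integral_comp_mul_left
    (fun x => Real.log ‖p.eval (circleMap 0 1 x)‖) Real.two_pi_pos.ne']
  simp

/-- The function `C - log |z|`, with value `∞` at `0`. -/
def logDefect (C : ℝ) (z : ℂ) : ℝ≥0∞ := if z = 0 then ⊤ else ENNReal.ofReal (C - Real.log ‖z‖)

theorem measurable_logDefect (C : ℝ) : Measurable (logDefect C) :=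
  Measurable.ite (measurableSet_singleton 0) measurable_const
    (measurable_const.sub (Real.measurable_log.comp measurable_norm)).ennreal_ofReal

theorem logDefect_of_ne_zero (C : ℝ) {z : ℂ} (hz : z ≠ 0) :
    logDefect C z = ENNReal.ofReal (C - Real.log ‖z‖) := if_neg hz

/-- The finitely many roots have finite preimage under the injective map `fourier 1`, and points of
the circle are null. -/
theorem ae_eval_fourier_ne_zero {p : Polynomial ℂ} (hp : p ≠ 0) :
    ∀ᵐ t : UnitAddCircle, p.eval (fourier 1 t) ≠ 0 := by
  have hinj : Function.Injective (fun t : UnitAddCircle => (fourier 1 t : ℂ)) := fun s t h => by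
    simp only [fourier_one] at h
    exact AddCircle.injective_toCircle one_ne_zero (Subtype.ext h)
  have hfin : {t : UnitAddCircle | p.eval (fourier 1 t) = 0}.Finite :=
    (p.roots.toFinset.finite_toSet.preimage hinj.injOn).subset fun t ht => by
      simpa [hp] using ht
  have hnull : volume {t : UnitAddCircle | p.eval (fourier 1 t) = 0} = 0 := ?_
  · rw [ae_iff]
    simpa only [not_not, ne_eq] using hnull
  rw [← Set.biUnion_of_singleton {t : UnitAddCircle | p.eval (fourier 1 t) = 0}]
  refine (measure_biUnion_null_iff hfin.countable).2 fun t _ => ?_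
  rw [← Metric.closedBall_zero, AddCircle.volume_closedBall]
  simp

theorem lintegral_logDefect_eval {p : Polynomial ℂ} (hp : p ≠ 0) {C : ℝ}
    (hC : ∀ z : ℂ, ‖z‖ = 1 → ‖p.eval z‖ ≤ Real.exp C) :
    ∫⁻ t : UnitAddCircle, logDefect C (p.eval (fourier 1 t)) =
      ENNReal.ofReal (C - p.logMahlerMeasure) := by
  have h0 := ae_eval_fourier_ne_zero hp
  rw [lintegral_congr_ae (h0.mono fun t ht => logDefect_of_ne_zero C ht),
    ← integral_log_norm_eval_fourier,
    ← ofReal_integral_eq_lintegral_ofReal (f := fun t => C - Real.log ‖p.eval (fourier 1 t)‖)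
      ((integrable_const C).sub (integrable_log_norm_eval_fourier p)),
    integral_sub (integrable_const C) (integrable_log_norm_eval_fourier p)]
  · simp
  · filter_upwards [h0] with t ht
    simp only [Pi.zero_apply, sub_nonneg]
    exact (Real.log_le_iff_le_exp (norm_pos_iff.2 ht)).2 (hC _ (norm_fourier_one t))

/-- Logarithmic form of the coefficient bound `|p_k| ≤ binom(deg p, k) M(p)`. When `p_k = 0` the
right side is `∞`, so vanishing coefficients need no separate hypothesis. -/
theorem lintegral_logDefect_eval_le (p : Polynomial ℂ) {C : ℝ}
    (hC : ∀ z : ℂ, ‖z‖ = 1 → ‖p.eval z‖ ≤ Real.exp C) {D : ℕ} (hD : p.natDegree ≤ D) {k : ℕ}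
    (hk : k ≤ D) :
    ∫⁻ t : UnitAddCircle, logDefect C (p.eval (fourier 1 t)) ≤
      logDefect C (p.coeff k) + ENNReal.ofReal (Real.log (D.choose k)) := by
  by_cases h0 : p.coeff k = 0
  · simp [logDefect, h0]
  have hp : p ≠ 0 := by rintro rfl; simp at h0
  have hch : (0 : ℝ) < D.choose k := by exact_mod_cast Nat.choose_pos hk
  have hch1 : (1 : ℝ) ≤ D.choose k := by exact_mod_cast Nat.choose_pos hk
  rw [lintegral_logDefect_eval hp hC, logDefect_of_ne_zero C h0]
  refine le_trans (ENNReal.ofReal_le_ofReal ?_) ENNReal.ofReal_add_le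
  have h1 : ‖p.coeff k‖ ≤ D.choose k * p.mahlerMeasure :=
    (p.norm_coeff_le_choose_mul_mahlerMeasure k).trans
      (mul_le_mul_of_nonneg_right (by exact_mod_cast Nat.choose_le_choose k hD)
        p.mahlerMeasure_nonneg)
  have h2 := Real.log_le_log (norm_pos_iff.2 h0) h1
  rw [Real.log_mul hch.ne' (p.mahlerMeasure_pos_of_ne_zero hp).ne',
    ← Polynomial.logMahlerMeasure_eq_log_MahlerMeasure] at h2
  linarith

/-- The value at a point of the torus of the polynomial with coefficients `a`, whose degree in
each variable is at most `B`. -/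
def boxEval {n B : ℕ} (a : (Fin n → Fin (B + 1)) → ℂ) (t : Fin n → UnitAddCircle) : ℂ :=
  ∑ α, a α * ∏ i, (fourier 1 (t i) : ℂ) ^ (α i : ℕ)

theorem continuous_boxEval {n B : ℕ} (a : (Fin n → Fin (B + 1)) → ℂ) :
    Continuous (boxEval a) := by
  unfold boxEval
  refine continuous_finsetSum _ fun α _ => continuous_const.mul (continuous_finsetProd _ fun i _ => ?_)
  exact ((fourier 1).continuous.comp (continuous_apply i)).pow _

theorem norm_boxEval_le {n B : ℕ} (a : (Fin n → Fin (B + 1)) → ℂ) (t : Fin n → UnitAddCircle) :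
    ‖boxEval a t‖ ≤ ∑ α, ‖a α‖ := by
  refine (norm_sum_le _ _).trans (Finset.sum_le_sum fun α _ => ?_)
  simp only [norm_mul, norm_prod, norm_pow, norm_fourier_one, one_pow, Finset.prod_const_one,
    mul_one, le_refl]

/-- The polynomial in the first variable obtained by fixing the other variables. -/
def boxSlice {n B : ℕ} (a : (Fin (n + 1) → Fin (B + 1)) → ℂ) (t : Fin n → UnitAddCircle) :
    Polynomial ℂ :=
  ∑ k : Fin (B + 1), Polynomial.monomial (k : ℕ) (boxEval (fun β => a (Fin.cons k β)) t)

theorem eval_boxSlice {n B : ℕ} (a : (Fin (n + 1) → Fin (B + 1)) → ℂ) (s : UnitAddCircle)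
    (t : Fin n → UnitAddCircle) :
    (boxSlice a t).eval (fourier 1 s) = boxEval a (Fin.cons s t) := by
  rw [boxSlice, boxEval, Polynomial.eval_finsetSum,
    ← (Fin.consEquiv fun _ : Fin (n + 1) => Fin (B + 1)).sum_comp, Fintype.sum_prod_type]
  refine Finset.sum_congr rfl fun k _ => ?_
  rw [Polynomial.eval_monomial, boxEval, Finset.sum_mul]
  refine Finset.sum_congr rfl fun β _ => ?_
  simp [Fin.consEquiv, Fin.prod_univ_succ]
  ring

theorem coeff_boxSlice {n B : ℕ} (a : (Fin (n + 1) → Fin (B + 1)) → ℂ)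
    (t : Fin n → UnitAddCircle) (k : Fin (B + 1)) :
    (boxSlice a t).coeff k = boxEval (fun β => a (Fin.cons k β)) t := by
  simp [boxSlice, Polynomial.coeff_monomial, Fin.val_inj]

theorem natDegree_boxSlice_le {n B D : ℕ} (a : (Fin (n + 1) → Fin (B + 1)) → ℂ)
    (ha : ∀ α, a α ≠ 0 → ∑ i, (α i : ℕ) ≤ D) (t : Fin n → UnitAddCircle) :
    (boxSlice a t).natDegree ≤ D := by
  refine Polynomial.natDegree_sum_le_of_forall_le _ _ fun k _ => ?_
  by_cases hk : (k : ℕ) ≤ D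
  · exact (Polynomial.natDegree_monomial_le _).trans hk
  · have : boxEval (fun β => a (Fin.cons k β)) t = 0 := by
      refine Finset.sum_eq_zero fun β _ => ?_
      have : a (Fin.cons k β) = 0 := by
        by_contra h
        have := ha _ h
        simp [Fin.sum_univ_succ] at this
        omega
      simp only [this, zero_mul]
    simp [this]

theorem sum_norm_cons {n B : ℕ} (a : (Fin (n + 1) → Fin (B + 1)) → ℂ) :
    ∑ α, ‖a α‖ = ∑ k : Fin (B + 1), ∑ β, ‖a (Fin.cons k β)‖ := by
  rw [← (Fin.consEquiv fun _ : Fin (n + 1) => Fin (B + 1)).sum_comp, Fintype.sum_prod_type]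
  rfl

/-- Tonelli: the one-variable inequality is applied to `boxSlice a t` for each fixed `t`, then
integrated in `t`. The bound on `∑ ‖a α‖` supplies the required bound on the unit circle for every
slice at once. -/
theorem lintegral_logDefect_boxEval_le {n B D : ℕ} (a : (Fin (n + 1) → Fin (B + 1)) → ℂ)
    (ha : ∀ α, a α ≠ 0 → ∑ i, (α i : ℕ) ≤ D) {C : ℝ} (hC : ∑ α, ‖a α‖ ≤ Real.exp C)
    (k : Fin (B + 1)) (hk : (k : ℕ) ≤ D) :
    ∫⁻ t : Fin (n + 1) → UnitAddCircle, logDefect C (boxEval a t) ≤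
      (∫⁻ t : Fin n → UnitAddCircle, logDefect C (boxEval (fun β => a (Fin.cons k β)) t)) +
        ENNReal.ofReal (Real.log (D.choose k)) := by
  have hmeas : ∀ {m : ℕ} (b : (Fin m → Fin (B + 1)) → ℂ),
      Measurable fun t => logDefect C (boxEval b t) := fun b =>
    (measurable_logDefect C).comp (continuous_boxEval b).measurable
  have hmp := (measurePreserving_piFinSuccAbove
    (fun _ : Fin (n + 1) => (volume : Measure UnitAddCircle)) 0).symm
  rw [volume_pi, ← hmp.lintegral_comp (hmeas a), lintegral_prod_symm
    (fun z => logDefect C (boxEval a ((MeasurableEquiv.piFinSuccAbove _ 0).symm z)))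
    (Measurable.aemeasurable ((hmeas a).comp (MeasurableEquiv.measurable _)))]
  have hrhs : (∫⁻ t : Fin n → UnitAddCircle,
      logDefect C (boxEval (fun β => a (Fin.cons k β)) t)) +
        ENNReal.ofReal (Real.log (D.choose k)) =
      ∫⁻ t : Fin n → UnitAddCircle, (logDefect C (boxEval (fun β => a (Fin.cons k β)) t) +
        ENNReal.ofReal (Real.log (D.choose k))) := by
    rw [lintegral_add_right _ measurable_const]
    simp
  rw [hrhs]
  refine lintegral_mono fun t => ?_
  have h := lintegral_logDefect_eval_le (boxSlice a t) (C := C) (D := D) (k := k) ?_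
    (natDegree_boxSlice_le a ha t) hk
  · rw [coeff_boxSlice] at h
    refine le_of_eq_of_le (lintegral_congr fun s => ?_) h
    rw [eval_boxSlice]
    exact congrArg (fun z => logDefect C (boxEval a z)) (Fin.insertNth_zero' s t)
  · intro z hz
    refine le_trans ?_ hC
    rw [boxSlice, Polynomial.eval_finsetSum, sum_norm_cons]
    refine (norm_sum_le _ _).trans (Finset.sum_le_sum fun j _ => ?_)
    rw [Polynomial.eval_monomial, norm_mul, norm_pow, hz, one_pow, mul_one]
    exact norm_boxEval_le _ _

/-- A polynomial of degree at most `D` in `n` variables: the sum of the absolute values of the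
coefficients is at most `(n + 1) ^ D` times the Mahler measure. -/
theorem sum_norm_le_exp_lintegral {n B : ℕ} (a : (Fin n → Fin (B + 1)) → ℂ) {D : ℕ}
    (ha : ∀ α, a α ≠ 0 → ∑ i, (α i : ℕ) ≤ D) {C : ℝ} (hC : ∑ α, ‖a α‖ ≤ Real.exp C)
    (h0 : a ≠ 0) :
    ∫⁻ t : Fin n → UnitAddCircle, logDefect C (boxEval a t) ≠ ⊤ ∧
      ∑ α, ‖a α‖ ≤ (n + 1) ^ D *
        Real.exp (C - (∫⁻ t : Fin n → UnitAddCircle, logDefect C (boxEval a t)).toReal) := by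
  induction n generalizing D with
  | zero =>
    obtain ⟨e, hd⟩ := Function.ne_iff.1 h0
    simp only [Pi.zero_apply] at hd
    have hs : ∀ {M : Type} [AddCommMonoid M] (f : (Fin 0 → Fin (B + 1)) → M),
        ∑ α, f α = f e := fun f => by
      rw [Fintype.sum_unique]
      exact congrArg f (Subsingleton.elim _ _)
    have hb : ∀ t, boxEval a t = a e := fun t => by rw [boxEval, hs]; simp
    rw [hs] at hC ⊢
    have hnn : 0 ≤ C - Real.log ‖a e‖ :=
      sub_nonneg.2 ((Real.log_le_iff_le_exp (norm_pos_iff.2 hd)).2 hC)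
    simp only [hb, logDefect_of_ne_zero C hd]
    rw [lintegral_const]
    simp [ENNReal.toReal_ofReal hnn, Real.exp_log (norm_pos_iff.2 hd)]
  | succ n ih =>
    set I := ∫⁻ t : Fin (n + 1) → UnitAddCircle, logDefect C (boxEval a t) with hI
    have hCk : ∀ k, ∑ β, ‖a (Fin.cons k β)‖ ≤ Real.exp C := fun k => by
      refine le_trans ?_ hC
      rw [sum_norm_cons]
      exact Finset.single_le_sum (f := fun k => ∑ β, ‖a (Fin.cons k β)‖)
        (fun j _ => Finset.sum_nonneg fun β _ => norm_nonneg _) (Finset.mem_univ k)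
    -- A nonzero slice has degree at most `D - k`, so the induction hypothesis applies to it; the
    -- same constant `C` serves all slices. One nonzero slice already forces `I` to be finite.
    have key : ∀ k : Fin (B + 1), (fun β => a (Fin.cons k β)) ≠ 0 → (k : ℕ) ≤ D ∧ I ≠ ⊤ ∧
        ∑ β, ‖a (Fin.cons k β)‖ ≤
          (n + 1) ^ (D - k) * (D.choose k * Real.exp (C - I.toReal)) := by
      intro k hk
      have hdeg : ∀ β, a (Fin.cons k β) ≠ 0 → (k : ℕ) + ∑ i, (β i : ℕ) ≤ D := fun β hβ => by
        simpa [Fin.sum_univ_succ] using ha _ hβ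
      have hkD : (k : ℕ) ≤ D := by
        obtain ⟨β, hβ⟩ := Function.ne_iff.1 hk
        have := hdeg β hβ
        omega
      obtain ⟨hfin, hle⟩ := ih (fun β => a (Fin.cons k β)) (D := D - k)
        (fun β hβ => by have := hdeg β hβ; omega) (hCk k) hk
      have hIle := lintegral_logDefect_boxEval_le a ha hC k hkD
      have htop := ENNReal.add_ne_top.2 ⟨hfin, ENNReal.ofReal_ne_top (r := Real.log (D.choose k))⟩
      refine ⟨hkD, ne_top_of_le_ne_top htop hIle, hle.trans ?_⟩
      have hch : (1 : ℝ) ≤ D.choose k := by exact_mod_cast Nat.choose_pos hkD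
      have hreal := ENNReal.toReal_mono htop hIle
      rw [ENNReal.toReal_add hfin ENNReal.ofReal_ne_top,
        ENNReal.toReal_ofReal (Real.log_nonneg hch)] at hreal
      refine mul_le_mul_of_nonneg_left ?_ (by positivity)
      nth_rewrite 1 [← Real.exp_log (zero_lt_one.trans_le hch)]
      rw [← Real.exp_add]
      exact Real.exp_le_exp.2 (by rw [hI]; linarith)
    obtain ⟨α, hα⟩ := Function.ne_iff.1 h0
    have hex : (fun β => a (Fin.cons (α 0) β)) ≠ 0 := fun h => hα (by
      have := congrFun h (Fin.tail α)
      simpa using this)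
    refine ⟨(key _ hex).2.1, ?_⟩
    rw [sum_norm_cons]
    have hterm : ∀ k : Fin (B + 1), ∑ β, ‖a (Fin.cons k β)‖ ≤
        if (k : ℕ) ≤ D then (n + 1 : ℝ) ^ (D - k) * D.choose k * Real.exp (C - I.toReal)
          else 0 := by
      intro k
      by_cases hk : (fun β => a (Fin.cons k β)) = 0
      · have : ∑ β, ‖a (Fin.cons k β)‖ = 0 :=
          Finset.sum_eq_zero fun β _ => by simpa using congrFun hk β
        rw [this]
        split_ifs <;> positivity
      · obtain ⟨h1, -, h2⟩ := key k hk
        rw [if_pos h1, mul_assoc]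
        exact h2
    refine (Finset.sum_le_sum fun k _ => hterm k).trans ?_
    rw [Fin.sum_univ_eq_sum_range (fun k => if k ≤ D then
      (n + 1 : ℝ) ^ (D - k) * D.choose k * Real.exp (C - I.toReal) else 0), ← Finset.sum_filter,
      ← Finset.sum_mul]
    refine mul_le_mul_of_nonneg_right ?_ (Real.exp_pos _).le
    -- The surviving terms are among those of the expansion of `(1 + (n + 1)) ^ D`; the missing ones
    -- are nonnegative.
    have hpow := add_pow (1 : ℝ) (n + 1) D
    rw [show ((n + 1 : ℕ) + 1 : ℝ) = 1 + (n + 1) by push_cast; ring, hpow]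
    simp only [one_pow, one_mul]
    refine Finset.sum_le_sum_of_subset_of_nonneg (fun k hk => ?_) fun k _ _ => by positivity
    simp only [Finset.mem_filter, Finset.mem_range] at hk ⊢
    omega

/-! ### A polytope is contained in the cone of its edges at a vertex -/

theorem toReal_injective {d : ℕ} : Function.Injective (toReal : (Fin d → ℤ) → Fin d → ℝ) :=
  fun m n h => funext fun i => by
    have := congrFun h i
    simpa [toReal] using this

section Edges

variable {d : ℕ} {K : Set (Fin d → ℝ)} {S : Fin d → ℤ}

/-- A finite set of lattice vectors is dual-generating for `K` at `S` if every linear form which is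
nonnegative on it attains its minimum over `K` at `S`. -/
def DualGenerates (K : Set (Fin d → ℝ)) (S : Fin d → ℤ) (W : Finset (Fin d → ℤ)) : Prop :=
  ∀ g : (Fin d → ℝ) →L[ℝ] ℝ, (∀ w ∈ W, 0 ≤ g (toReal w)) → ∀ x ∈ K, g (toReal S) ≤ g x

/-- An extreme point is not in the convex hull of the other generators, so it can be strictly
separated from that compact hull. -/
theorem exists_pos_of_vertex {V : Finset (Fin d → ℤ)}
    (hS : toReal S ∈ (convexHull ℝ (toReal '' (V : Set (Fin d → ℤ)))).extremePoints ℝ) :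
    ∃ p : (Fin d → ℝ) →L[ℝ] ℝ, ∀ v ∈ V, v ≠ S → p (toReal S) < p (toReal v) := by
  set A : Set (Fin d → ℝ) := toReal '' ((V : Set (Fin d → ℤ)) \ {S}) with hA
  have hfin : A.Finite := (V.finite_toSet.subset Set.sdiff_subset).image _
  have hnot : toReal S ∉ convexHull ℝ A := by
    intro h
    have hsub : A ⊆ convexHull ℝ (toReal '' (V : Set (Fin d → ℤ))) \ {toReal S} := by
      rintro _ ⟨v, ⟨hv, hvS⟩, rfl⟩
      exact ⟨subset_convexHull ℝ _ ⟨v, hv, rfl⟩, fun h => hvS (toReal_injective h)⟩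
    have hconv := ((convex_convexHull ℝ _).mem_extremePoints_iff_convex_sdiff.1 hS).2
    exact (convexHull_min hsub hconv h).2 rfl
  obtain ⟨f, u, hfu, hb⟩ := geometric_hahn_banach_point_closed (convex_convexHull ℝ A)
    (hfin.isClosed_convexHull ℝ) hnot
  exact ⟨f, fun v hv hvS => hfu.trans (hb _ (subset_convexHull ℝ _ ⟨v, ⟨hv, hvS⟩, rfl⟩))⟩

/-- In a minimal dual-generating set every vector spans an edge. -/
theorem exists_support_of_minimal {W : Finset (Fin d → ℤ)} {w : Fin d → ℤ}
    (hw : w ∈ W) {p : (Fin d → ℝ) →L[ℝ] ℝ} (hp : ∀ w ∈ W, 0 < p (toReal w))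
    (hW : DualGenerates K S W) (hmin : ¬ DualGenerates K S (W.erase w)) :
    ∃ u : (Fin d → ℝ) →L[ℝ] ℝ, u (toReal w) = 0 ∧ ∀ v ∈ W, v ≠ w → 0 < u (toReal v) := by
  classical
  unfold DualGenerates at hmin
  push Not at hmin
  obtain ⟨g, hg, x, hxK, hgx⟩ := hmin
  have hgw : g (toReal w) < 0 := by
    by_contra! h
    refine absurd (hW g (fun v hv => ?_) x hxK) (not_le.2 hgx)
    by_cases hvw : v = w
    · rwa [hvw]
    · exact hg v (Finset.mem_erase.2 ⟨hvw, hv⟩)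
  set A : Set (Fin d → ℝ) := toReal '' ((W.erase w : Finset _) : Set (Fin d → ℤ)) with hA
  have hfin : A.Finite := (Finset.finite_toSet _).image _
  -- On the hull `p > 0` and `g ≥ 0`. A common point `c • w` would have `c > 0` by `p`, and then `g
  -- (c • w) < 0`.
  have hdisj : Disjoint (convexHull ℝ A) (Set.range fun c : ℝ => c • toReal w) := by
    rw [Set.disjoint_left]
    rintro _ ha ⟨c, rfl⟩
    have h1 : convexHull ℝ A ⊆ {a | 0 ≤ g a} := convexHull_min
      (by rintro _ ⟨v, hv, rfl⟩; exact hg v hv)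
      (convex_halfSpace_ge g.isLinear 0)
    have h2 : convexHull ℝ A ⊆ {a | 0 < p a} := convexHull_min
      (by rintro _ ⟨v, hv, rfl⟩; exact hp v (Finset.mem_of_mem_erase hv))
      (convex_halfSpace_gt p.isLinear 0)
    have h3 := h1 ha
    have h4 := h2 ha
    simp only [Set.mem_ofPred_eq, map_smul, smul_eq_mul] at h3 h4
    have := hp w hw
    have hc : 0 < c := pos_of_mul_pos_left h4 this.le
    nlinarith
  obtain ⟨f, s, t, hfs, hst, hft⟩ := geometric_hahn_banach_compact_closed (convex_convexHull ℝ A)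
    (hfin.isCompact_convexHull ℝ)
    (by
      rintro _ ⟨a, rfl⟩ _ ⟨b, rfl⟩ r q _ _ _
      exact ⟨r * a + q * b, by simp only [add_smul, mul_smul]⟩)
    (isClosedMap_smul_left (𝕜 := ℝ) (toReal w)).isClosed_range hdisj
  -- A form bounded below on a line through the origin vanishes on it; since `f < t < 0` on `A`, the
  -- form `-f` is the required one.
  have ht0 : t < 0 := by simpa using hft _ ⟨0, rfl⟩
  have hfw : f (toReal w) = 0 := by
    by_contra h
    have := hft _ ⟨t / f (toReal w), rfl⟩
    rw [map_smul, smul_eq_mul, div_mul_cancel₀ _ h] at this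
    exact lt_irrefl _ this
  refine ⟨-f, by simp [hfw], fun v hv hvw => ?_⟩
  have := hfs _ (subset_convexHull ℝ A ⟨v, Finset.mem_erase.2 ⟨hvw, hv⟩, rfl⟩)
  simp only [_root_.neg_apply]
  linarith

/-- A Farkas argument: a form `g` separating `x - S` from the ray is corrected by a large multiple
of `u`. The correction changes neither `g w` nor `g (x - S)`, yet makes the form nonnegative on all
of `W`. -/
theorem mem_ray_of_support {W : Finset (Fin d → ℤ)} {w : Fin d → ℤ} (hW : DualGenerates K S W)
    {u : (Fin d → ℝ) →L[ℝ] ℝ} (hu : ∀ v ∈ W, v ≠ w → 0 < u (toReal v))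
    (huw : u (toReal w) = 0) {x : Fin d → ℝ} (hx : x ∈ K) (hux : u x = u (toReal S)) :
    ∃ c : ℝ, 0 ≤ c ∧ x - toReal S = c • toReal w := by
  by_contra! hcon
  have hnot : x - toReal S ∉ (fun c : ℝ => c • toReal w) '' Set.Ici 0 := by
    rintro ⟨c, hc, h⟩
    exact hcon c hc h.symm
  obtain ⟨g, s, hgx, hgs⟩ := geometric_hahn_banach_point_closed
    (by
      rintro _ ⟨a, ha, rfl⟩ _ ⟨b, hb, rfl⟩ r q hr hq _
      refine ⟨r * a + q * b, ?_, by simp only [add_smul, mul_smul]⟩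
      exact add_nonneg (mul_nonneg hr ha) (mul_nonneg hq hb))
    ((isClosedMap_smul_left (𝕜 := ℝ) (toReal w)) _ isClosed_Ici) hnot
  have hs0 : s < 0 := by simpa using hgs _ ⟨0, Set.self_mem_Ici, rfl⟩
  have hgw : 0 ≤ g (toReal w) := by
    by_contra! h
    have := hgs _ ⟨s / g (toReal w), div_nonneg_of_nonpos hs0.le h.le, rfl⟩
    simp only [map_smul, smul_eq_mul, div_mul_cancel₀ _ h.ne] at this
    exact lt_irrefl _ this
  obtain ⟨M, hM0, hM⟩ : ∃ M : ℝ, 0 ≤ M ∧ ∀ v ∈ W, v ≠ w → 0 ≤ g (toReal v) + M * u (toReal v) := by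
    have hnn : ∀ v ∈ W.erase w, 0 ≤ |g (toReal v)| / u (toReal v) := fun v hv =>
      div_nonneg (abs_nonneg _) (hu v (Finset.mem_of_mem_erase hv) (Finset.ne_of_mem_erase hv)).le
    refine ⟨∑ v ∈ W.erase w, |g (toReal v)| / u (toReal v), Finset.sum_nonneg hnn,
      fun v hv hvw => ?_⟩
    have hpos := hu v hv hvw
    have h1 := Finset.single_le_sum hnn (Finset.mem_erase.2 ⟨hvw, hv⟩)
    rw [div_le_iff₀ hpos] at h1
    have := neg_abs_le (g (toReal v))
    linarith
  have := hW (g + M • u) (fun v hv => by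
    by_cases hvw : v = w
    · simpa [hvw, huw] using hgw
    · simpa using hM v hv hvw) x hx
  simp only [_root_.add_apply, _root_.smul_apply, smul_eq_mul, hux] at this
  rw [map_sub] at hgx
  linarith

theorem isEdge_of_support {W : Finset (Fin d → ℤ)} {w : Fin d → ℤ} (hw0 : w ≠ 0)
    (hSK : toReal S ∈ K) (hwK : toReal (S + w) ∈ K) (hW : DualGenerates K S W)
    {u : (Fin d → ℝ) →L[ℝ] ℝ} (hu : ∀ v ∈ W, v ≠ w → 0 < u (toReal v))
    (huw : u (toReal w) = 0) : IsEdge K {x ∈ K | u x = u (toReal S)} := by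
  have hmin : ∀ x ∈ K, u (toReal S) ≤ u x := hW u fun v hv => by
    by_cases hvw : v = w
    · rw [hvw, huw]
    · exact (hu v hv hvw).le
  have hSF : toReal S ∈ {x ∈ K | u x = u (toReal S)} := ⟨hSK, rfl⟩
  have hwF : toReal (S + w) ∈ {x ∈ K | u x = u (toReal S)} :=
    ⟨hwK, by rw [toReal_add, map_add, huw, add_zero]⟩
  refine ⟨⟨⟨_, hSF⟩, fun _ => ⟨-u, ?_⟩⟩, ?_⟩
  · ext x
    simp only [Set.mem_ofPred_eq, _root_.neg_apply, neg_le_neg_iff]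
    refine and_congr_right fun hx => ⟨fun h y hy => h ▸ hmin y hy, fun h => ?_⟩
    exact le_antisymm (h _ hSK) (hmin x hx)
  · have hspan : vectorSpan ℝ {x ∈ K | u x = u (toReal S)} = Submodule.span ℝ {toReal w} := by
      apply le_antisymm
      · rw [vectorSpan_eq_span_vsub_set_right ℝ hSF, Submodule.span_le]
        rintro _ ⟨x, ⟨hxK, hx⟩, rfl⟩
        obtain ⟨c, -, hc⟩ := mem_ray_of_support hW hu huw hxK hx
        exact Submodule.mem_span_singleton.2 ⟨c, hc.symm⟩
      · rw [Submodule.span_singleton_le_iff_mem]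
        have := vsub_mem_vectorSpan ℝ hwF hSF
        rwa [vsub_eq_sub, toReal_add, add_sub_cancel_left] at this
    rw [hspan, finrank_span_singleton]
    intro h
    exact hw0 (toReal_injective (h.trans toReal_zero.symm))

/-- A lattice vector along an edge is a positive multiple of an edge vector. -/
theorem exists_edgeVector {F : Set (Fin d → ℝ)} (hF : IsEdge K F) (hSF : toReal S ∈ F)
    {w : Fin d → ℤ} (hw0 : w ≠ 0) (hwF : toReal (S + w) ∈ F)
    (hray : ∀ x ∈ F, ∃ c : ℝ, 0 ≤ c ∧ x - toReal S = c • toReal w) :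
    ∃ l ∈ edgeVectors K S, ∃ c : ℝ, 0 ≤ c ∧ toReal w = c • toReal l := by
  obtain ⟨j, hj⟩ := Function.ne_iff.1 hw0
  have hray' : ∀ l : Fin d → ℤ, l ≠ 0 → toReal (S + l) ∈ F →
      ∃ c : ℝ, 0 < c ∧ toReal l = c • toReal w := by
    intro l hl hlF
    obtain ⟨c, hc, h⟩ := hray _ hlF
    rw [toReal_add, add_sub_cancel_left] at h
    refine ⟨c, hc.lt_of_ne fun h0 => hl (toReal_injective ?_), h⟩
    rw [h, ← h0, zero_smul, toReal_zero]
  -- All lattice points of the edge lie on one ray from `S`, so distance from `S` is measured by any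
  -- coordinate `j` with `w j ≠ 0`.
  obtain ⟨l, ⟨hl0, hlF⟩, hlmin⟩ := exists_minimalFor_of_wellFoundedLT
    (fun l : Fin d → ℤ => l ≠ 0 ∧ toReal (S + l) ∈ F) (fun l => (l j).natAbs) ⟨w, hw0, hwF⟩
  obtain ⟨c, hc, hcl⟩ := hray' l hl0 hlF
  refine ⟨l, ⟨F, hF, hSF, hl0, hlF, fun l' hl'0 hl'F => ?_⟩, c⁻¹, (inv_pos.2 hc).le, ?_⟩
  · obtain ⟨c', hc', hcl'⟩ := hray' l' hl'0 hl'F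
    have hle : (l j).natAbs ≤ (l' j).natAbs := by
      rcases le_total (l j).natAbs (l' j).natAbs with h | h
      · exact h
      · exact hlmin ⟨hl'0, hl'F⟩ h
    have hwj : 0 < |(w j : ℝ)| := abs_pos.2 (by exact_mod_cast hj)
    have habs : ∀ {m : Fin d → ℤ} {e : ℝ}, 0 < e → toReal m = e • toReal w →
        ((m j).natAbs : ℝ) = e * |(w j : ℝ)| := by
      intro m e he hm
      have := congrFun hm j
      simp only [toReal, Pi.smul_apply, smul_eq_mul] at this
      rw [Nat.cast_natAbs, Int.cast_abs, this, abs_mul, abs_of_pos he]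
    have hcc : c ≤ c' := by
      have h : ((l j).natAbs : ℝ) ≤ (l' j).natAbs := by exact_mod_cast hle
      rw [habs hc hcl, habs hc' hcl'] at h
      exact le_of_mul_le_mul_right h hwj
    rw [segment_eq_image']
    refine ⟨c / c', ⟨by positivity, (div_le_one hc').2 hcc⟩, ?_⟩
    simp only [toReal_add, add_sub_cancel_left, hcl, hcl', smul_smul, div_mul_cancel₀ _ hc'.ne']
  · rw [hcl, smul_smul, inv_mul_cancel₀ hc.ne', one_smul]

/-- A linear form nonnegative on the edge vectors at a vertex `S` attains its minimum at `S`. -/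
theorem le_of_nonneg_edgeVectors (hK : IsLatticePolytope K) (hS : S ∈ vertices K)
    (g : (Fin d → ℝ) →L[ℝ] ℝ) (hg : ∀ l ∈ edgeVectors K S, 0 ≤ g (toReal l)) :
    ∀ x ∈ K, g (toReal S) ≤ g x := by
  classical
  obtain ⟨V, -, hV⟩ := hK
  have hVK : ∀ v ∈ V, toReal v ∈ K := fun v hv => hV ▸ subset_convexHull ℝ _ ⟨v, hv, rfl⟩
  have hS' := hS
  rw [vertices, Set.mem_ofPred_eq, hV] at hS'
  obtain ⟨p, hp⟩ := exists_pos_of_vertex hS'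
  set V0 : Finset (Fin d → ℤ) := (V.erase S).image fun v => v - S with hV0
  have hV0p : ∀ w ∈ V0, 0 < p (toReal w) ∧ toReal (S + w) ∈ K := by
    intro w hw
    obtain ⟨v, hv, rfl⟩ := Finset.mem_image.1 hw
    refine ⟨?_, by rw [add_sub_cancel]; exact hVK v (Finset.mem_of_mem_erase hv)⟩
    rw [toReal_sub, map_sub, sub_pos]
    exact hp v (Finset.mem_of_mem_erase hv) (Finset.ne_of_mem_erase hv)
  have hgen : DualGenerates K S V0 := by
    intro f hf
    have : K ⊆ {x | f (toReal S) ≤ f x} := by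
      rw [hV]
      refine convexHull_min ?_ (convex_halfSpace_ge f.isLinear _)
      rintro _ ⟨v, hv, rfl⟩
      by_cases hvS : v = S
      · rw [hvS]; exact le_refl (f (toReal S))
      · have := hf _ (Finset.mem_image.2 ⟨v, Finset.mem_erase.2 ⟨hvS, hv⟩, rfl⟩)
        rw [toReal_sub, map_sub, sub_nonneg] at this
        exact this
    exact fun x hx => this hx
  -- Discarding redundant generators leaves only vectors along edges, which are nonnegative
  -- multiples of edge vectors.
  obtain ⟨W, ⟨hWV, hWgen⟩, hWmin⟩ := exists_minimalFor_of_wellFoundedLT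
    (fun W : Finset (Fin d → ℤ) => W ⊆ V0 ∧ DualGenerates K S W) Finset.card
    ⟨V0, subset_rfl, hgen⟩
  refine hWgen g fun w hw => ?_
  have hnot : ¬ DualGenerates K S (W.erase w) := fun h => by
    have h1 := Finset.card_erase_lt_of_mem hw
    exact absurd (hWmin ⟨(Finset.erase_subset _ _).trans hWV, h⟩ h1.le) (not_le.2 h1)
  obtain ⟨u, huw, hu⟩ := exists_support_of_minimal hw (fun v hv => (hV0p v (hWV hv)).1) hWgen hnot
  have hw0 : w ≠ 0 := by
    rintro rfl
    have := (hV0p 0 (hWV hw)).1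
    rw [toReal_zero, map_zero] at this
    exact lt_irrefl _ this
  have hSK : toReal S ∈ K := hS.1
  have hwK := (hV0p w (hWV hw)).2
  obtain ⟨l, hl, c, hc, hwl⟩ := exists_edgeVector (isEdge_of_support hw0 hSK hwK hWgen hu huw)
    ⟨hSK, rfl⟩ hw0 ⟨hwK, by rw [toReal_add, map_add, huw, add_zero]⟩
    (fun x hx => mem_ray_of_support hWgen hu huw hx.1 hx.2)
  rw [hwl, map_smul]
  exact mul_nonneg hc (hg l hl)

end Edges

/-! ### Lattice points in the coordinates attached to a vertex -/

section Coordinates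

variable {d : ℕ} {K : Set (Fin d → ℝ)} {S : Fin d → ℤ}

theorem IsLatticePolytope.isCompact (hK : IsLatticePolytope K) : IsCompact K := by
  obtain ⟨V, -, rfl⟩ := hK
  exact (V.finite_toSet.image _).isCompact_convexHull ℝ

theorem IsLatticePolytope.convex (hK : IsLatticePolytope K) : Convex ℝ K := by
  obtain ⟨V, -, rfl⟩ := hK
  exact convex_convexHull ℝ _

theorem IsLatticePolytope.nonempty (hK : IsLatticePolytope K) : K.Nonempty := by
  obtain ⟨V, ⟨v, hv⟩, rfl⟩ := hK
  exact ⟨_, subset_convexHull ℝ _ ⟨v, hv, rfl⟩⟩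

theorem IsLatticePolytope.exists_toReal_of_extreme (hK : IsLatticePolytope K) {x : Fin d → ℝ}
    (hx : x ∈ K.extremePoints ℝ) : ∃ P ∈ vertices K, toReal P = x := by
  have hx' := hx
  obtain ⟨V, -, rfl⟩ := hK
  obtain ⟨v, -, rfl⟩ := extremePoints_convexHull_subset hx'
  exact ⟨v, hx, rfl⟩

theorem IsLatticePolytope.finite_vertices (hK : IsLatticePolytope K) : (vertices K).Finite := by
  obtain ⟨V, -, rfl⟩ := hK
  refine V.finite_toSet.subset fun v hv => ?_
  obtain ⟨v', hv', h⟩ := extremePoints_convexHull_subset hv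
  exact toReal_injective h ▸ hv'

theorem IsLatticePolytope.vertices_nonempty (hK : IsLatticePolytope K) :
    (vertices K).Nonempty := by
  obtain ⟨x, hx⟩ := hK.isCompact.extremePoints_nonempty hK.nonempty
  obtain ⟨P, hP, -⟩ := hK.exists_toReal_of_extreme hx
  exact ⟨P, hP⟩

theorem IsLatticePolytope.finite_lattice_points (hK : IsLatticePolytope K) :
    {m : Fin d → ℤ | toReal m ∈ K}.Finite := by
  obtain ⟨R, hR⟩ := hK.isCompact.isBounded.exists_norm_le
  refine (Set.finite_Icc (fun _ : Fin d => -⌈R⌉) fun _ => ⌈R⌉).subset fun m hm => ?_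
  have h : ∀ i, |m i| ≤ ⌈R⌉ := fun i => by
    have h1 := (norm_le_pi_norm (toReal m) i).trans (hR _ hm)
    simp only [toReal, Real.norm_eq_abs] at h1
    exact_mod_cast h1.trans (Int.le_ceil R)
  exact ⟨fun i => (abs_le.1 (h i)).1, fun i => (abs_le.1 (h i)).2⟩

/-- The real linear form extending a linear form on the lattice. -/
def realForm (φ : (Fin d → ℤ) →ₗ[ℤ] ℤ) : (Fin d → ℝ) →L[ℝ] ℝ :=
  ∑ j, (φ (Pi.single j 1) : ℝ) • ContinuousLinearMap.proj j

theorem realForm_toReal (φ : (Fin d → ℤ) →ₗ[ℤ] ℤ) (m : Fin d → ℤ) :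
    realForm φ (toReal m) = φ m := by
  have h : φ m = ∑ j, m j * φ (Pi.single j 1) := by
    conv_lhs => rw [← Finset.univ_sum_single m, map_sum]
    refine Finset.sum_congr rfl fun j _ => ?_
    have : (Pi.single j (m j) : Fin d → ℤ) = m j • Pi.single j 1 := by
      rw [← Pi.single_smul, smul_eq_mul, mul_one]
    rw [this, map_smul, smul_eq_mul]
  rw [h, realForm]
  simp [toReal, mul_comm]

/-- The basis attached to a vertex, indexed by `Fin d`. -/
def vertexBasis (hs : IsAbsolutelySimple K) (hS : S ∈ vertices K) :
    Module.Basis (Fin d) ℤ (Fin d → ℤ) :=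
  (edgeBasis hs hS).reindex ((edgeBasis hs hS).indexEquiv (Pi.basisFun ℤ (Fin d)))

theorem vertexBasis_repr_edgeVector (hs : IsAbsolutelySimple K) (hS : S ∈ vertices K)
    {l : Fin d → ℤ} (hl : l ∈ edgeVectors K S) (i : Fin d) :
    0 ≤ (vertexBasis hs hS).repr l i := by
  classical
  have : edgeBasis hs hS ⟨l, hl⟩ = l := Module.Basis.mk_apply _ _ _
  rw [vertexBasis, Module.Basis.repr_reindex_apply]
  nth_rewrite 1 [← this]
  rw [Module.Basis.repr_self, Finsupp.single_apply]
  split_ifs <;> norm_num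

theorem vertexNorm_eq_sum (hs : IsAbsolutelySimple K) (hS : S ∈ vertices K) (P : Fin d → ℤ) :
    vertexNorm hs hS P = ∑ i, (vertexBasis hs hS).repr (P - S) i := by
  classical
  set e := (edgeBasis hs hS).indexEquiv (Pi.basisFun ℤ (Fin d))
  let _ : Fintype (edgeVectors K S) := Fintype.ofEquiv _ e.symm
  rw [vertexNorm, Finsupp.sum_fintype _ _ fun _ => rfl, ← e.symm.sum_comp]
  simp only [vertexBasis, Module.Basis.repr_reindex_apply]
  rfl

theorem vertexBasis_repr_nonneg (hK : IsLatticePolytope K) (hs : IsAbsolutelySimple K)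
    (hS : S ∈ vertices K) {m : Fin d → ℤ} (hm : toReal m ∈ K) (i : Fin d) :
    0 ≤ (vertexBasis hs hS).repr (m - S) i := by
  have h := le_of_nonneg_edgeVectors hK hS (realForm ((vertexBasis hs hS).coord i))
    (fun l hl => by
      rw [realForm_toReal]
      exact_mod_cast vertexBasis_repr_edgeVector hs hS hl i) _ hm
  rw [realForm_toReal, realForm_toReal] at h
  rw [map_sub, Finsupp.sub_apply, sub_nonneg]
  exact_mod_cast h

theorem vertexNorm_nonneg (hK : IsLatticePolytope K) (hs : IsAbsolutelySimple K)
    (hS : S ∈ vertices K) {m : Fin d → ℤ} (hm : toReal m ∈ K) : 0 ≤ vertexNorm hs hS m := by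
  rw [vertexNorm_eq_sum]
  exact Finset.sum_nonneg fun i _ => vertexBasis_repr_nonneg hK hs hS hm i

theorem bddAbove_vertexNorm (hK : IsLatticePolytope K) (hs : IsAbsolutelySimple K) :
    BddAbove {n | ∃ (S S' : Fin d → ℤ) (hS : S ∈ vertices K), S' ∈ vertices K ∧ S' ≠ S ∧
      n = vertexNorm hs hS S'} := by
  have := hK.finite_vertices.to_subtype
  refine ((Set.finite_range fun p : vertices K × vertices K =>
    vertexNorm hs p.1.2 p.2.1).subset ?_).bddAbove
  rintro _ ⟨S, S', hS, hS', -, rfl⟩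
  exact ⟨(⟨S, hS⟩, ⟨S', hS'⟩), rfl⟩

theorem polytopeNorm_nonneg (hK : IsLatticePolytope K) (hs : IsAbsolutelySimple K) :
    0 ≤ polytopeNorm hs := by
  unfold polytopeNorm
  rcases Set.eq_empty_or_nonempty {n | ∃ (S S' : Fin d → ℤ) (hS : S ∈ vertices K),
    S' ∈ vertices K ∧ S' ≠ S ∧ n = vertexNorm hs hS S'} with h | ⟨n, hn⟩
  -- Without two distinct vertices the supremum is the default value `0`.
  · rw [h, Int.csSup_empty]
  · refine le_trans ?_ (le_csSup (bddAbove_vertexNorm hK hs) hn)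
    obtain ⟨S, S', hS, hS', -, rfl⟩ := hn
    exact vertexNorm_nonneg hK hs hS hS'.1

/-- The norm `N_S` is at most `N(K)` on all lattice points of `K`. -/
theorem vertexNorm_le_polytopeNorm (hK : IsLatticePolytope K) (hs : IsAbsolutelySimple K)
    (hS : S ∈ vertices K) {m : Fin d → ℤ} (hm : toReal m ∈ K) :
    vertexNorm hs hS m ≤ polytopeNorm hs := by
  set f := realForm (∑ i, (vertexBasis hs hS).coord i) with hf
  have hfv : ∀ P, (vertexNorm hs hS P : ℝ) = f (toReal P) - f (toReal S) := fun P => by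
    rw [hf, realForm_toReal, realForm_toReal, vertexNorm_eq_sum]
    simp
  have hsub : K ⊆ {x | f x ≤ f (toReal S) + polytopeNorm hs} := by
    -- Krein–Milman reduces the bound to vertices, where it is the definition of `polytopeNorm`.
    refine (closure_convexHull_extremePoints hK.isCompact hK.convex).symm.subset.trans ?_
    refine closure_minimal (convexHull_min ?_ (convex_halfSpace_le f.isLinear _))
      (isClosed_le f.continuous continuous_const)
    intro x hx
    obtain ⟨P, hP, rfl⟩ := hK.exists_toReal_of_extreme hx
    have hPle : vertexNorm hs hS P ≤ polytopeNorm hs := by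
      by_cases hPS : P = S
      · rw [hPS, vertexNorm_eq_sum]
        simpa using polytopeNorm_nonneg hK hs
      · exact le_csSup (bddAbove_vertexNorm hK hs) ⟨S, P, hS, hP, hPS, rfl⟩
    have h : (vertexNorm hs hS P : ℝ) ≤ polytopeNorm hs := by exact_mod_cast hPle
    rw [hfv] at h
    exact sub_le_iff_le_add'.1 h
  have h : f (toReal m) ≤ f (toReal S) + polytopeNorm hs := hsub hm
  rw [← sub_le_iff_le_add', ← hfv] at h
  exact_mod_cast h

end Coordinates

/-! ### Lelong's constants -/

/-- For `d = 1` this is an equality, `∑ 1/(i 2^i) = log 2`. For `d ≥ 2` the harmonic sum up to `2d -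
2 ≥ d` suffices, and the remaining terms are nonnegative. -/
theorem log_add_one_le_lelongC {d : ℕ} (hd : 0 < d) :
    Real.log (d + 1) ≤ lelongC d + lelongC' d := by
  rcases Nat.lt_or_ge d 2 with h | h
  · obtain rfl : d = 1 := by omega
    have h1 := Real.hasSum_pow_div_log_of_abs_lt_one (x := 1 / 2) (by norm_num [abs_lt])
    have h2 : (fun k : ℕ => 1 / (((2 * 1 - 1 + k : ℕ) : ℝ) * 2 ^ (2 * 1 - 1 + k))) =
        fun n : ℕ => (1 / 2 : ℝ) ^ (n + 1) / (n + 1) := by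
      funext n
      rw [show 2 * 1 - 1 + n = n + 1 by omega, one_div_pow, div_div, mul_comm]
      push_cast
      rfl
    rw [lelongC, lelongC', h2, h1.tsum_eq]
    norm_num [← Real.log_inv]
  · have hC : 0 ≤ lelongC d := by
      unfold lelongC
      positivity
    have htail : 0 ≤ ∑' k : ℕ, 1 / (((2 * d - 1 + k : ℕ) : ℝ) * 2 ^ (2 * d - 1 + k)) :=
      tsum_nonneg fun k => by positivity
    have hharm := log_add_one_le_harmonic (2 * d - 2)
    rw [harmonic_eq_sum_Icc] at hharm
    push_cast at hharm
    have hle : Real.log (d + 1) ≤ Real.log (((2 * d - 2 : ℕ) : ℝ) + 1) := by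
      refine Real.log_le_log (by positivity) ?_
      have : d ≤ 2 * d - 2 := by omega
      gcongr
    rw [lelongC']
    simp only [one_div] at htail ⊢
    linarith

/-! ### Monomial changes of coordinates on the torus -/

section Torus

variable {d : ℕ}

theorem addChar_sum {A R ι : Type*} [AddCommMonoid A] [CommMonoid R] (ψ : AddChar A R)
    (s : Finset ι) (f : ι → A) : ψ (∑ i ∈ s, f i) = ∏ i ∈ s, ψ (f i) := by
  classical
  induction s using Finset.induction_on with
  | empty => simp
  | insert i s hi ih => rw [Finset.sum_insert hi, Finset.prod_insert hi, ψ.map_add_eq_mul, ih]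

/-- The character of the lattice `M` given by a point of the compact torus. -/
def torusChar (t : Fin d → UnitAddCircle) : AddChar (Fin d → ℤ) ℂ where
  toFun m := UnitAddTorus.mFourier m t
  map_zero_eq_one' := by rw [UnitAddTorus.mFourier_zero]; rfl
  map_add_eq_mul' _ _ := UnitAddTorus.mFourier_add

theorem torusChar_apply (t : Fin d → UnitAddCircle) (m : Fin d → ℤ) :
    torusChar t m = UnitAddTorus.mFourier m t := rfl

theorem norm_torusChar (t : Fin d → UnitAddCircle) (m : Fin d → ℤ) : ‖torusChar t m‖ = 1 := by
  rw [torusChar_apply]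
  change ‖∏ i, (fourier (m i) (t i) : ℂ)‖ = 1
  simp only [norm_prod, fourier_apply, Circle.norm_coe, Finset.prod_const_one]

/-- The endomorphism of the torus given by the characters `χ^{b i}`. -/
def torusHom (b : Fin d → Fin d → ℤ) : (Fin d → UnitAddCircle) →+ (Fin d → UnitAddCircle) where
  toFun t i := ∑ j, b i j • t j
  map_zero' := by funext i; simp
  map_add' s t := by funext i; simp [smul_add, Finset.sum_add_distrib]

theorem torusHom_apply (b : Fin d → Fin d → ℤ) (t : Fin d → UnitAddCircle) (i : Fin d) :
    torusHom b t i = ∑ j, b i j • t j := rfl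

theorem continuous_torusHom (b : Fin d → Fin d → ℤ) : Continuous (torusHom b) :=
  continuous_pi fun i => by
    simp only [torusHom_apply]
    exact continuous_finsetSum _ fun j _ => (continuous_apply j).zsmul _

theorem fourier_one_torusHom (b : Fin d → Fin d → ℤ) (t : Fin d → UnitAddCircle) (i : Fin d) :
    (fourier 1 (torusHom b t i) : ℂ) = torusChar t (b i) := by
  rw [torusChar_apply, fourier_one, torusHom_apply]
  change ((AddCircle.toCircle_addChar (∑ j, b i j • t j) : Circle) : ℂ) =
    ∏ j, (fourier (b i j) (t j) : ℂ)
  rw [addChar_sum]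
  exact map_prod Circle.coeHom _ _

theorem torusHom_surjective (b : Module.Basis (Fin d) ℤ (Fin d → ℤ)) :
    Function.Surjective (torusHom b) := by
  intro s
  -- The preimage is given by the inverse integer matrix, the coordinates of the standard basis in
  -- `b`.
  refine ⟨fun j => ∑ k, b.repr (Pi.single j 1) k • s k, funext fun i => ?_⟩
  have h : ∀ k, ∑ j, b i j * b.repr (Pi.single j 1) k = if i = k then 1 else 0 := by
    intro k
    have h1 : ∑ j, b i j • (Pi.single j 1 : Fin d → ℤ) = b i := by
      conv_rhs => rw [← Finset.univ_sum_single (b i)]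
      refine Finset.sum_congr rfl fun j _ => ?_
      rw [← Pi.single_smul, smul_eq_mul, mul_one]
    have h2 := congrArg (fun v => b.repr v k) h1
    simp only [map_sum, map_smul, Finsupp.finsetSum_apply, Finsupp.smul_apply, smul_eq_mul,
      Module.Basis.repr_self, Finsupp.single_apply] at h2
    exact h2
  simp only [torusHom_apply, Finset.smul_sum, smul_smul]
  rw [Finset.sum_comm]
  simp only [← Finset.sum_smul, h, ite_smul, one_smul, zero_smul]
  simp

/-- Uniqueness of Haar measure: a continuous surjective endomorphism of a compact group preserves
it. -/
theorem measurePreserving_torusHom (b : Module.Basis (Fin d) ℤ (Fin d → ℤ)) :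
    MeasurePreserving (torusHom b) (volume : Measure (Fin d → UnitAddCircle)) volume :=
  AddMonoidHom.measurePreserving (continuous_torusHom _) (torusHom_surjective b) rfl

/-- Returns from `logDefect` to the Bochner integral used in `mahler`. Finiteness gives nonvanishing
almost everywhere and integrability, so the integral is not a default value. -/
theorem integral_log_norm_boxEval {n B : ℕ} (a : (Fin n → Fin (B + 1)) → ℂ) {C : ℝ}
    (hC : ∑ α, ‖a α‖ ≤ Real.exp C)
    (hfin : ∫⁻ t : Fin n → UnitAddCircle, logDefect C (boxEval a t) ≠ ⊤) :
    ∫ t : Fin n → UnitAddCircle, Real.log ‖boxEval a t‖ =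
      C - (∫⁻ t : Fin n → UnitAddCircle, logDefect C (boxEval a t)).toReal := by
  have hcont := (continuous_boxEval a).measurable
  have hne : ∀ᵐ t, boxEval a t ≠ 0 := by
    filter_upwards [ae_lt_top ((measurable_logDefect C).comp hcont) hfin] with t ht h0
    simp [logDefect, h0] at ht
  have hmeas : Measurable fun t => C - Real.log ‖boxEval a t‖ :=
    measurable_const.sub (Real.measurable_log.comp hcont.norm)
  have hnn : 0 ≤ᵐ[volume] fun t => C - Real.log ‖boxEval a t‖ := by
    filter_upwards [hne] with t ht
    exact sub_nonneg.2 ((Real.log_le_iff_le_exp (norm_pos_iff.2 ht)).2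
      ((norm_boxEval_le a t).trans hC))
  have hlin : ∫⁻ t : Fin n → UnitAddCircle, ENNReal.ofReal (C - Real.log ‖boxEval a t‖) =
      ∫⁻ t : Fin n → UnitAddCircle, logDefect C (boxEval a t) :=
    lintegral_congr_ae (hne.mono fun t ht => (logDefect_of_ne_zero C ht).symm)
  have hint : Integrable fun t => C - Real.log ‖boxEval a t‖ :=
    (lintegral_ofReal_ne_top_iff_integrable hmeas.aestronglyMeasurable hnn).1 (hlin ▸ hfin)
  have h1 := integral_eq_lintegral_of_nonneg_ae hnn hmeas.aestronglyMeasurable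
  rw [hlin] at h1
  have h2 : ∫ t : Fin n → UnitAddCircle, (C - (C - Real.log ‖boxEval a t‖)) =
      C - ∫ t : Fin n → UnitAddCircle, (C - Real.log ‖boxEval a t‖) := by
    rw [integral_sub (integrable_const C) hint]
    simp
  simp only [sub_sub_cancel] at h2
  rw [h2, h1]

/-- The sum of the absolute values of the coefficients of a Laurent polynomial whose exponents
have, in suitable lattice coordinates, nonnegative coordinates with sum at most `B`. -/
theorem sum_norm_coeff_le_exp_mahler (f : Laurent d) (hf : f ≠ 0)
    (b : Module.Basis (Fin d) ℤ (Fin d → ℤ)) (S : Fin d → ℤ) {B : ℕ}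
    (hnn : ∀ m ∈ f.coeff.support, ∀ i, 0 ≤ b.repr (m - S) i)
    (hsum : ∀ m ∈ f.coeff.support, ∑ i, b.repr (m - S) i ≤ B) :
    ∑ m ∈ f.coeff.support, ‖f.coeff m‖ ≤ (d + 1) ^ B * Real.exp (mahler f) := by
  classical
  set pt : (Fin d → Fin (B + 1)) → (Fin d → ℤ) := fun α => S + ∑ i, (α i : ℕ) • b i with hpt
  have hrepr : ∀ α i, b.repr (pt α - S) i = (α i : ℕ) := by
    intro α i
    rw [hpt, add_sub_cancel_left, map_sum]
    simp only [map_nsmul, Module.Basis.repr_self, Finsupp.finsetSum_apply, Finsupp.smul_apply,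
      Finsupp.single_apply]
    simp
  have hinj : Function.Injective pt := fun α β h => funext fun i => Fin.ext (by
    have := hrepr α i
    rw [h, hrepr] at this
    exact_mod_cast this.symm)
  have himage : f.coeff.support ⊆ Finset.univ.image pt := by
    intro m hm
    have hlt : ∀ i, (b.repr (m - S) i).toNat < B + 1 := fun i => by
      have h1 := Finset.single_le_sum (fun i _ => hnn m hm i) (Finset.mem_univ i)
      have h2 := hsum m hm
      have h3 := hnn m hm i
      omega
    refine Finset.mem_image.2 ⟨fun i => ⟨_, hlt i⟩, Finset.mem_univ _, ?_⟩
    refine sub_left_injective (b := S) (b.ext_elem fun i => ?_)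
    simp only [hrepr]
    exact Int.toNat_of_nonneg (hnn m hm i)
  have htransfer : ∀ {A : Type} [AddCommMonoid A] (F : (Fin d → ℤ) → A),
      (∀ m, f.coeff m = 0 → F m = 0) → ∑ m ∈ f.coeff.support, F m = ∑ α, F (pt α) := by
    intro A _ F hF
    rw [Finset.sum_subset himage fun m _ hm => hF m (Finsupp.notMem_support_iff.1 hm),
      Finset.sum_image fun α _ β _ h => hinj h]
  set a : (Fin d → Fin (B + 1)) → ℂ := fun α => f.coeff (pt α) with ha
  have ha0 : a ≠ 0 := by
    intro h
    obtain ⟨m, hm⟩ := Finsupp.support_nonempty_iff.2 fun h0 : f.coeff = 0 =>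
      hf (AddMonoidAlgebra.ext h0)
    obtain ⟨α, -, rfl⟩ := Finset.mem_image.1 (himage hm)
    exact Finsupp.mem_support_iff.1 hm (congrFun h α)
  have hadeg : ∀ α, a α ≠ 0 → ∑ i, (α i : ℕ) ≤ B := by
    intro α hα
    have := hsum (pt α) (Finsupp.mem_support_iff.2 hα)
    simp only [hrepr] at this
    exact_mod_cast this
  have hpos : 0 < ∑ α, ‖a α‖ := by
    obtain ⟨α, hα⟩ := Function.ne_iff.1 ha0
    exact Finset.sum_pos' (fun _ _ => norm_nonneg _) ⟨α, Finset.mem_univ _, norm_pos_iff.2 hα⟩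
  -- Here `C` is the logarithm of the coefficient sum; it cancels once the defect is turned back
  -- into the Mahler measure.
  have hC : ∑ α, ‖a α‖ ≤ Real.exp (Real.log (∑ α, ‖a α‖)) := (Real.exp_log hpos).ge
  have heval : ∀ t : Fin d → UnitAddCircle,
      ‖f.coeff.sum fun m c => c * UnitAddTorus.mFourier m t‖ = ‖boxEval a (torusHom b t)‖ := by
    intro t
    rw [Finsupp.sum, htransfer (fun m => f.coeff m * UnitAddTorus.mFourier m t)
      (fun m hm => by simp only [hm, zero_mul])]
    have : ∀ α, f.coeff (pt α) * UnitAddTorus.mFourier (pt α) t =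
        torusChar t S * (a α * ∏ i, (fourier 1 (torusHom b t i) : ℂ) ^ (α i : ℕ)) := by
      intro α
      rw [← torusChar_apply, hpt, AddChar.map_add_eq_mul, addChar_sum]
      simp only [AddChar.map_nsmul_eq_pow, fourier_one_torusHom, ha, hpt]
      ring
    simp only [this]
    rw [← Finset.mul_sum, norm_mul, norm_torusChar, one_mul, boxEval]
  obtain ⟨hfin, hle⟩ := sum_norm_le_exp_lintegral a hadeg hC ha0
  rw [htransfer (fun m => ‖f.coeff m‖) (fun m hm => by rw [hm, norm_zero])]
  refine hle.trans_eq ?_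
  rw [← integral_log_norm_boxEval a hC hfin, mahler]
  simp only [haarAddCircle_one, heval]
  have hmap := integral_map (μ := volume) (φ := torusHom b) (f := fun t => Real.log ‖boxEval a t‖)
    (continuous_torusHom _).measurable.aemeasurable
    (Real.measurable_log.comp (continuous_boxEval a).measurable.norm).aestronglyMeasurable
  rw [(measurePreserving_torusHom b).map_eq] at hmap
  rw [hmap, volume_pi]

end Torus

/-! ### The canonical metric -/

section Metric

variable {d : ℕ} {K : Set (Fin d → ℝ)}

theorem IsLatticePolytope.isLeast_supportFunction (hK : IsLatticePolytope K) (u : Fin d → ℝ) :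
    ∃ w ∈ K, supportFunction K u = w ⬝ᵥ u ∧ ∀ v ∈ K, w ⬝ᵥ u ≤ v ⬝ᵥ u := by
  obtain ⟨w, hw, hmin⟩ := hK.isCompact.exists_isMinOn hK.nonempty
    (f := fun v => v ⬝ᵥ u) (by fun_prop)
  refine ⟨w, hw, IsLeast.csInf_eq ⟨⟨w, hw, rfl⟩, ?_⟩, fun v hv => hmin hv⟩
  rintro _ ⟨v, hv, rfl⟩
  exact hmin hv

/-- The normal fan is complete. -/
theorem exists_mem_normalFan (hK : IsLatticePolytope K) (u : Fin d → ℝ) :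
    ∃ σ ∈ normalFan K, u ∈ σ := by
  obtain ⟨w, hw, -, hmin⟩ := hK.isLeast_supportFunction u
  refine ⟨_, ⟨{x ∈ K | ∀ v ∈ K, x ⬝ᵥ u ≤ v ⬝ᵥ u}, ⟨⟨w, hw, hmin⟩, fun _ =>
    ⟨-∑ j, u j • ContinuousLinearMap.proj j, ?_⟩⟩, rfl⟩, fun x hx => hx.2⟩
  ext x
  have h : ∀ y : Fin d → ℝ, (-∑ j, u j • ContinuousLinearMap.proj (R := ℝ) j :
      (Fin d → ℝ) →L[ℝ] ℝ) y = -(y ⬝ᵥ u) := fun y => by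
    simp [dotProduct, mul_comm]
  simp only [h, neg_le_neg_iff]

/-- A point outside `K` is separated from it by some `u`, which violates the support inequality at
`u`. -/
theorem polytope_polytopeDivisor (hK : IsLatticePolytope K) : (polytopeDivisor hK).polytope = K := by
  ext v
  constructor
  · intro hv
    by_contra hvK
    obtain ⟨f, s, hfv, hfK⟩ := geometric_hahn_banach_point_closed hK.convex
      hK.isCompact.isClosed hvK
    have hf : ∀ x : Fin d → ℝ, x ⬝ᵥ (fun j => f (Pi.single j 1)) = f x := fun x => by
      conv_rhs => rw [← Finset.univ_sum_single x, map_sum]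
      refine Finset.sum_congr rfl fun j _ => ?_
      rw [← smul_eq_mul, ← map_smul, ← Pi.single_smul, smul_eq_mul, mul_one]
    obtain ⟨w, hw, hsupp, -⟩ := hK.isLeast_supportFunction fun j => f (Pi.single j 1)
    have h := hv fun j => f (Pi.single j 1)
    rw [show (polytopeDivisor hK).supp = supportFunction K from rfl, hsupp, hf, hf] at h
    linarith [hfK w hw]
  · intro hv u
    obtain ⟨w, -, hsupp, hmin⟩ := hK.isLeast_supportFunction u
    exact hsupp.trans_le (hmin v hv)

variable {Δ : Set (Set (Fin d → ℝ))} {D : InvariantDivisor Δ}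

theorem GlobalSection.coeff_add_loc (s : GlobalSection D) (σ : Δ) (k : dualMonoid σ.1) :
    s.fn.coeff (k + D.loc σ) = (s.coord σ).coeff k := by
  rw [s.fn_eq σ, AddMonoidAlgebra.coeff_mul_single_eq_coeff_mul k.1 (by simp), mul_one, toLaurent,
    AddMonoidAlgebra.mapDomainAlgHom_apply, AddMonoidAlgebra.coeff_mapDomain]
  exact Finsupp.mapDomain_apply Subtype.val_injective _ _

theorem GlobalSection.sub_loc_mem (s : GlobalSection D) (σ : Δ) {m : Fin d → ℤ}
    (hm : s.fn.coeff m ≠ 0) : m - D.loc σ ∈ dualMonoid σ.1 := by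
  rw [s.fn_eq σ, AddMonoidAlgebra.coeff_mul_single_eq_coeff_mul (m - D.loc σ)
    (by simp [eq_sub_iff_add_eq]), mul_one, toLaurent, AddMonoidAlgebra.mapDomainAlgHom_apply,
    AddMonoidAlgebra.coeff_mapDomain] at hm
  by_contra h
  exact hm (Finsupp.mapDomain_of_notMem_range _ _ (by simpa using h))

/-- Regularity on the chart of a cone gives the support inequality for `u` in that cone;
completeness of the fan gives it for all `u`. -/
theorem GlobalSection.toReal_mem (hK : IsLatticePolytope K)
    (s : GlobalSection (polytopeDivisor hK)) {m : Fin d → ℤ} (hm : s.fn.coeff m ≠ 0) :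
    toReal m ∈ K := by
  rw [← polytope_polytopeDivisor hK]
  intro u
  obtain ⟨σ, hσ, hu⟩ := exists_mem_normalFan hK u
  have h := s.sub_loc_mem ⟨σ, hσ⟩ hm u hu
  rw [toReal_sub, sub_dotProduct, ← (polytopeDivisor hK).supp_eq ⟨σ, hσ⟩ u hu] at h
  exact sub_nonneg.1 h

theorem apply_eq_sum_character {σ : Set (Fin d → ℝ)} (x : AffinePoints σ) (f : CoordRing σ) :
    x f = ∑ k ∈ f.coeff.support, f.coeff k * x (character k) := by
  conv_lhs => rw [← AddMonoidAlgebra.sum_coeff_single f, Finsupp.sum, map_sum]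
  refine Finset.sum_congr rfl fun k _ => ?_
  rw [character, ← smul_eq_mul, ← map_smul, AddMonoidAlgebra.smul_single, smul_eq_mul, mul_one]

/-- Triangle inequality in the chart: each character in the numerator is one of those in the
supremum below. This holds at boundary points too, so no maximum principle is needed. -/
theorem chartNorm_le_sum_norm_coeff (hfin : {m : Fin d → ℤ | toReal m ∈ D.polytope}.Finite)
    (s : GlobalSection D) (hs : ∀ m, s.fn.coeff m ≠ 0 → toReal m ∈ D.polytope)
    (p : Σ σ : Δ, AffinePoints σ.1) :
    chartNorm D s p ≤ ∑ m ∈ s.fn.coeff.support, ‖s.fn.coeff m‖ := by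
  classical
  obtain ⟨σ, x⟩ := p
  have := hfin.to_subtype
  set g : {m : Fin d → ℤ // toReal m ∈ D.polytope} → ℝ := fun m =>
    ‖x (character ⟨m.1 - D.loc σ, D.sub_loc_mem σ m.2⟩)‖ with hg
  have hbdd : BddAbove (Set.range g) := (Set.finite_range (ι := {m : Fin d → ℤ |
    toReal m ∈ D.polytope}) g).bddAbove
  have hG : 0 ≤ ⨆ m, g m := Real.iSup_nonneg fun m => norm_nonneg _
  change ‖x (s.coord σ)‖ / (⨆ m, g m) ≤ _
  refine div_le_of_le_mul₀ hG (Finset.sum_nonneg fun _ _ => norm_nonneg _) ?_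
  rw [apply_eq_sum_character]
  have hsupp : ∀ k ∈ (s.coord σ).coeff.support, s.fn.coeff (k + D.loc σ) ≠ 0 := fun k hk => by
    rw [s.coeff_add_loc]
    exact Finsupp.mem_support_iff.1 hk
  have h1 : ∀ k ∈ (s.coord σ).coeff.support, ‖(s.coord σ).coeff k * x (character k)‖ ≤
      ‖s.fn.coeff (k + D.loc σ)‖ * ⨆ m, g m := by
    intro k hk
    rw [norm_mul, s.coeff_add_loc]
    refine mul_le_mul_of_nonneg_left ?_ (norm_nonneg _)
    refine le_of_eq_of_le ?_ (le_ciSup hbdd ⟨k + D.loc σ, hs _ (hsupp k hk)⟩)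
    simp only [hg, add_sub_cancel_right]
  refine (norm_sum_le _ _).trans ((Finset.sum_le_sum h1).trans ?_)
  rw [← Finset.sum_mul]
  refine mul_le_mul_of_nonneg_right ?_ hG
  rw [← Finset.sum_image (f := fun m => ‖s.fn.coeff m‖)
    (g := fun k : dualMonoid σ.1 => (k : Fin d → ℤ) + D.loc σ)
    (fun k _ k' _ h => Subtype.ext (add_right_cancel h))]
  refine Finset.sum_le_sum_of_subset_of_nonneg (fun m hm => ?_) fun _ _ _ => norm_nonneg _
  obtain ⟨k, hk, rfl⟩ := Finset.mem_image.1 hm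
  exact Finsupp.mem_support_iff.2 (hsupp k hk)

theorem canonicalNorm_le_sum_norm_coeff (hK : IsLatticePolytope K)
    (s : GlobalSection (polytopeDivisor hK)) (x : ComplexPoints (normalFan K)) :
    canonicalNorm (polytopeDivisor hK) s x ≤ ∑ m ∈ s.fn.coeff.support, ‖s.fn.coeff m‖ := by
  induction x using Quot.ind with
  | mk p =>
    refine chartNorm_le_sum_norm_coeff ?_ s (fun m hm => ?_) p <;> rw [polytope_polytopeDivisor hK]
    · exact hK.finite_lattice_points
    · exact s.toReal_mem hK hm

theorem canonicalNorm_le (hK : IsLatticePolytope K) (hs : IsAbsolutelySimple K)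
    (s : GlobalSection (polytopeDivisor hK)) (h0 : s.fn ≠ 0) (x : ComplexPoints (normalFan K)) :
    canonicalNorm (polytopeDivisor hK) s x ≤
      Real.exp (Real.log (d + 1) * polytopeNorm hs + mahler s.fn) := by
  obtain ⟨S, hS⟩ := hK.vertices_nonempty
  have hN := polytopeNorm_nonneg hK hs
  have hmem : ∀ m ∈ s.fn.coeff.support, toReal m ∈ K := fun m hm =>
    s.toReal_mem hK (Finsupp.mem_support_iff.1 hm)
  have h := sum_norm_coeff_le_exp_mahler s.fn h0 (vertexBasis hs hS) S
    (B := (polytopeNorm hs).toNat)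
    (fun m hm i => vertexBasis_repr_nonneg hK hs hS (hmem m hm) i)
    (fun m hm => by
      rw [← vertexNorm_eq_sum, Int.toNat_of_nonneg hN]
      exact vertexNorm_le_polytopeNorm hK hs hS (hmem m hm))
  refine (canonicalNorm_le_sum_norm_coeff hK s x).trans (h.trans_eq ?_)
  have hcast : ((polytopeNorm hs : ℤ) : ℝ) = ((polytopeNorm hs).toNat : ℝ) := by
    exact_mod_cast (Int.toNat_of_nonneg hN).symm
  rw [Real.exp_add, hcast, mul_comm (Real.log _), Real.exp_nat_mul, Real.exp_log (by positivity)]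

end Metric

end Toric

end

theorem mainTheorem11 (d : ℕ) (hd : 0 < d) (K : Set (Fin d → ℝ))
    (hK : Toric.IsLatticePolytope K) (hs : Toric.IsAbsolutelySimple K) :
    Toric.invariantL hK ≤
      (((Toric.lelongC d + Toric.lelongC' d) * (Toric.polytopeNorm hs : ℝ) : ℝ) : EReal) := by
  refine iSup₂_le fun s h0 => ?_
  -- The Mahler measure is a real number, so it can be moved across; the bound is then checked
  -- pointwise in `x`.
  rw [EReal.sub_le_iff_le_add (Or.inl (EReal.coe_ne_bot _)) (Or.inl (EReal.coe_ne_top _)),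
    ← EReal.coe_add]
  refine iSup_le fun x => ?_
  refine (ENNReal.log_monotone (ENNReal.ofReal_le_ofReal
    (Toric.canonicalNorm_le hK hs s h0 x))).trans ?_
  rw [ENNReal.log_ofReal_of_pos (Real.exp_pos _), Real.log_exp, EReal.coe_le_coe_iff]
  have hN : (0 : ℝ) ≤ Toric.polytopeNorm hs := by exact_mod_cast Toric.polytopeNorm_nonneg hK hs
  have := mul_le_mul_of_nonneg_right (Toric.log_add_one_le_lelongC hd) hN
  linarith
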